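/- **Setting.** Let $n,d\ge 0$ be integers, $\Omega\subset\mathbb R^n$ (with the subspace topology), and let $(\Omega,\mathcal A,\mu)$ be a $\sigma$-finite complete measure space. Let $\mathcal K_{bcs}(\mathbb R^d)$ be the collection of nonempty, closed, bounded, convex sets $S\subset\mathbb R^d$ with $-S=S$, equipped with $S+S'=\{s+s'\}$ and $\lambda S=\{\lambda s\}$ ($\lambda\in\mathbb R$). A function $F:\Omega\to\mathcal K_{bcs}(\mathbb R^d)$ is measurable if $\{x: F(x)\cap U\neq\emptyset\}\in\mathcal A$ for every open $U\subset\mathbb R^d$. It is locally integrably bounded if it is measurable and there is a non-negative $k\in L^1_{loc}(\Omega,\mu)$ with $F(x)\subset\{v:|v|\le k(x)\}$ for a.e. $x$. Let $X$ be the set of all locally integrably bounded $F:\Omega\to\mathcal K_{bcs}(\mathbb R^d)$. A norm function on $\Omega$ is a map $\rho:\Omega\times\mathbb R^d\to[0,\infty)$ such that $\rho_x=\rho(x,\cdot)$ is a norm for every $x$ and $x\mapsto\rho_x(v)$ is measurable for every $v$. For $S\subset\mathbb R^d$ put $\rho_x(S)=\sup_{v\in S}\rho_x(v)$. For $0<p<\infty$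 let $$\|F\|_{L^p_{\mathcal K}(\Omega,\rho)}=\Big(\int_\Omega \rho_x(F(x))^p\,d\mu(x)\Big)^{1/p},$$ and let $L^p_{\mathcal K}(\Omega,\rho)$ be the set of measurable $F:\Omega\to\mathcal K_{bcs}(\mathbb R^d)$ for which this is finite. For $g:\mathbb R^d\to[0,\infty)$ put $g^*(v)=\sup\{|\langle v,w\rangle|: w\in\mathbb R^d,\ g(w)\le1\}$. **Theorem 4.1.** Let $1\le p_0,p_1,q_0,q_1<\infty$, let $\rho_0,\rho_1$ be norm functions on $\Omega$, and let $T:X\to X$ be linear and monotone, that is, for all $F,G\in X$ and $\lambda\in\mathbb R$, $$T(F+G)=TF+TG,\qquad T(\lambda F)=\lambda\,TF\quad\text{a.e.},$$ and $F\subset G$ pointwise on $\Omega$ implies $TF\subset TG$ a.e. Suppose that there are constants $M_0,M_1\ge0$ with $$\|TF\|_{L^{q_0}_{\mathcal K}(\Omega,\rho_0)}\le M_0\|F\|_{L^{p_0}_{\mathcal K}(\Omega,\rho_0)}\quad\text{for all }F\in X\cap L^{p_0}_{\mathcal K}(\Omega,\rho_0),$$ $$\|TF\|_{L^{q_1}_{\mathcal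 K}(\Omega,\rho_1)}\le M_1\|F\|_{L^{p_1}_{\mathcal K}(\Omega,\rho_1)}\quad\text{for all }F\in X\cap L^{p_1}_{\mathcal K}(\Omega,\rho_1).$$ Suppose also that whenever $A\in\mathcal A$, $S\in\mathcal K_{bcs}(\mathbb R^d)$, $\chi_AS\in X$ (where $\chi_AS$ equals $S$ on $A$ and $\{0\}$ off $A$) and both functions $x\mapsto(\rho_i)_x(\chi_A(x)S)$, $i=0,1$, are bounded, then both functions $x\mapsto(\rho_i)_x(T(\chi_AS)(x))$, $i=0,1$, are essentially bounded. Let $0<\theta<1$, let $$\frac1p=\frac{1-\theta}{p_0}+\frac{\theta}{p_1},\qquad \frac1q=\frac{1-\theta}{q_0}+\frac{\theta}{q_1},$$ and let $\rho_x=\big((\rho_0)_x^{1-\theta}(\rho_1)_x^{\theta}\big)^{**}$ be the double dual of the weighted geometric mean of $\rho_0$ and $\rho_1$. Then there is a constant $M_\theta\ge0$, independent of $F$, such that $$\|TF\|_{L^{q}_{\mathcal K}(\Omega,\rho)}\le M_\theta\|F\|_{L^{p}_{\mathcal K}(\Omega,\rho)}$$ for all $F\in X\cap L^p_{\mathcal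 K}(\Omega,\rho)$, in particular for all such simple (finitely valued) functions. Moreover, $T$ extends from $X\cap L^p_{\mathcal K}(\Omega,\rho)$ to a linear, monotone operator (in the same almost-everywhere sense) from $L^p_{\mathcal K}(\Omega,\rho)$ to $L^q_{\mathcal K}(\Omega,\rho)$ that satisfies the same inequality for all $F\in L^p_{\mathcal K}(\Omega,\rho)$; the extension agrees with $T$ a.e. -/

import Mathlib

open MeasureTheory
open scoped Pointwise ENNReal NNReal

namespace ConvexSetValued

/-- `𝒦_bcs(ℝᵈ)`: nonempty, closed, bounded, convex, symmetric subsets of `ℝᵈ`. -/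
structure IsKbcs {d : ℕ} (S : Set (EuclideanSpace ℝ (Fin d))) : Prop where
  nonempty : S.Nonempty
  isClosed : IsClosed S
  isBounded : Bornology.IsBounded S
  convex : Convex ℝ S
  symmetric : -S = S

/-- Measurability of a set-valued function: preimages `{x | F x ∩ U ≠ ∅}` of open sets
are measurable. -/
def SetMeasurable {Ω : Type*} [MeasurableSpace Ω] {d : ℕ}
    (F : Ω → Set (EuclideanSpace ℝ (Fin d))) : Prop :=
  ∀ U : Set (EuclideanSpace ℝ (Fin d)), IsOpen U → MeasurableSet {x | (F x ∩ U).Nonempty}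

/-- Measurable functions `Ω → 𝒦_bcs(ℝᵈ)`. -/
structure IsKbcsFun {Ω : Type*} [MeasurableSpace Ω] {d : ℕ}
    (F : Ω → Set (EuclideanSpace ℝ (Fin d))) : Prop where
  isKbcs : ∀ x, IsKbcs (F x)
  measurable : SetMeasurable F

/-- The set of all locally integrably bounded functions `Ω → 𝒦_bcs(ℝᵈ)`. -/
def LocIntBdd {Ω : Type*} [TopologicalSpace Ω] [MeasurableSpace Ω] (μ : Measure Ω) (d : ℕ) :
    Set (Ω → Set (EuclideanSpace ℝ (Fin d))) :=
  {F | IsKbcsFun F ∧ ∃ k : Ω → ℝ, (∀ x, 0 ≤ k x) ∧ LocallyIntegrable k μ ∧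
    ∀ᵐ x ∂μ, F x ⊆ Metric.closedBall 0 (k x)}

/-- Norm functions on `Ω`: each `ρ x` is a norm on `ℝᵈ`, and `x ↦ ρ x v` is measurable
for every `v`. -/
structure IsNormFunction {Ω : Type*} [MeasurableSpace Ω] {d : ℕ}
    (ρ : Ω → EuclideanSpace ℝ (Fin d) → ℝ) : Prop where
  nonneg : ∀ x v, 0 ≤ ρ x v
  add_le : ∀ x u v, ρ x (u + v) ≤ ρ x u + ρ x v
  smul : ∀ x (a : ℝ) v, ρ x (a • v) = |a| * ρ x v
  eq_zero : ∀ x v, ρ x v = 0 → v = 0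
  measurable : ∀ v, Measurable fun x => ρ x v

/-- `p(S) = sup_{v ∈ S} p(v)`, as an element of `[0, ∞]`. -/
noncomputable def supOn {d : ℕ} (p : EuclideanSpace ℝ (Fin d) → ℝ)
    (S : Set (EuclideanSpace ℝ (Fin d))) : ℝ≥0∞ :=
  ⨆ v ∈ S, ENNReal.ofReal (p v)

/-- `‖F‖_{L^p_𝒦(Ω, ρ)} = (∫ ρ_x(F(x))^p dμ(x))^{1/p}` for `0 < p < ∞`, as an element of
`[0, ∞]`. -/
noncomputable def normLpK {Ω : Type*} [MeasurableSpace Ω] {d : ℕ} (μ : Measure Ω) (p : ℝ)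
    (ρ : Ω → EuclideanSpace ℝ (Fin d) → ℝ) (F : Ω → Set (EuclideanSpace ℝ (Fin d))) : ℝ≥0∞ :=
  (∫⁻ x, supOn (ρ x) (F x) ^ p ∂μ) ^ (1 / p)

/-- The space `L^p_𝒦(Ω, ρ)`. -/
def LpK {Ω : Type*} [MeasurableSpace Ω] {d : ℕ} (μ : Measure Ω) (p : ℝ)
    (ρ : Ω → EuclideanSpace ℝ (Fin d) → ℝ) : Set (Ω → Set (EuclideanSpace ℝ (Fin d))) :=
  {F | IsKbcsFun F ∧ normLpK μ p ρ F < ∞}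

/-- The dual `p*(v) = sup {|⟨v, w⟩| : p(w) ≤ 1}`. -/
noncomputable def dual {d : ℕ} (p : EuclideanSpace ℝ (Fin d) → ℝ) :
    EuclideanSpace ℝ (Fin d) → ℝ :=
  fun v => sSup {r : ℝ | ∃ w, p w ≤ 1 ∧ r = |inner ℝ v w|}

/-- The weighted geometric mean `p_θ(v) = p₀(v)^{1-θ} p₁(v)^θ`. -/
noncomputable def geomMean {d : ℕ} (θ : ℝ) (p₀ p₁ : EuclideanSpace ℝ (Fin d) → ℝ) :
    EuclideanSpace ℝ (Fin d) → ℝ :=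
  fun v => p₀ v ^ (1 - θ) * p₁ v ^ θ

/-- `ρ_θ**`, the pointwise double dual of the weighted geometric mean of `ρ₀` and `ρ₁`. -/
noncomputable def interpNorm {Ω : Type*} {d : ℕ} (θ : ℝ)
    (ρ₀ ρ₁ : Ω → EuclideanSpace ℝ (Fin d) → ℝ) : Ω → EuclideanSpace ℝ (Fin d) → ℝ :=
  fun x => dual (dual (geomMean θ (ρ₀ x) (ρ₁ x)))

/-- `T` is linear and monotone on the class `D` of set-valued functions, where the functions
`T F` are only considered up to null sets. -/
structure IsLinearMonotoneOn {Ω : Type*} [MeasurableSpace Ω] {d : ℕ} (μ : Measure Ω)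
    (D : Set (Ω → Set (EuclideanSpace ℝ (Fin d))))
    (T : (Ω → Set (EuclideanSpace ℝ (Fin d))) → Ω → Set (EuclideanSpace ℝ (Fin d))) : Prop where
  map_add : ∀ F ∈ D, ∀ G ∈ D, ∀ᵐ x ∂μ, T (fun y => F y + G y) x = T F x + T G x
  map_smul : ∀ (c : ℝ), ∀ F ∈ D, ∀ᵐ x ∂μ, T (fun y => c • F y) x = c • T F x
  mono : ∀ F ∈ D, ∀ G ∈ D, (∀ x, F x ⊆ G x) → ∀ᵐ x ∂μ, T F x ⊆ T G x

/-- The function `χ_A S`, equal to `S` on `A` and to `{0}` off `A` (for nonempty `S`). -/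
noncomputable def chi {Ω : Type*} {d : ℕ} (A : Set Ω) (S : Set (EuclideanSpace ℝ (Fin d))) :
    Ω → Set (EuclideanSpace ℝ (Fin d)) :=
  fun x => A.indicator (fun _ => (1 : ℝ)) x • S

end ConvexSetValued

open ConvexSetValued

/-!
Put `N x = ρ_x(F(x))` and let `Fᵢ x` be the `(ρᵢ)_x`-ball of radius `N x ^ (p / pᵢ)`. Then
`F ⊆ t ^ θ • F₀ + t ^ (θ - 1) • F₁` for every `t > 0`, by separation: a functional bounded by
`αᵢ * ρᵢ` for `i = 0, 1` is bounded by `α₀ ^ (1 - θ) * α₁ ^ θ` times the geometric mean. A linear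
monotone `T` preserves these inclusions, off a single null set for all rational `t`. Conversely, a
vector in all the sums `t ^ θ • S₀ + t ^ (θ - 1) • S₁` has `ρ`-norm at most a multiple of
`ρ₀(S₀) ^ (1 - θ) * ρ₁(S₁) ^ θ`: in dimension one choose `t` to balance the two terms, and in
general split off, one at a time, rank-one projections that are contractive for both norms. The
bound for `T` follows by Hölder's inequality.

The `Fᵢ` need not be locally integrably bounded, so one truncates to sets increasing to `Ω`. What
removes the truncation, and also defines the extension of `T`, is that `T` is continuous along
restrictions to increasing sets. If `B k` decreases to a null set, then along a subsequence the
number of `B k` containing `x` is a multiplier `N x` for which `N • F` is still locally integrably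
bounded, and `m • 1_{B m} F ⊆ N • F` forces `T (1_{B m} F)` to shrink to zero.
-/

namespace ConvexSetValued

/-- The predicate that a function on a real vector space is a norm. -/
structure IsNorm {E : Type*} [AddCommGroup E] [Module ℝ E] (g : E → ℝ) : Prop where
  nonneg : ∀ v, 0 ≤ g v
  add_le : ∀ u v, g (u + v) ≤ g u + g v
  smul : ∀ (a : ℝ) v, g (a • v) = |a| * g v
  eq_zero : ∀ v, g v = 0 → v = 0

/-- Gauges of symmetric star bodies: unlike norms they need not be subadditive, so that geometric
means of two norms are included. -/
structure IsGauge {E : Type*} [TopologicalSpace E] [AddCommGroup E] [Module ℝ E]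
    (g : E → ℝ) : Prop where
  continuous : Continuous g
  smul : ∀ (a : ℝ) v, g (a • v) = |a| * g v
  pos : ∀ v, v ≠ 0 → 0 < g v

namespace IsNorm

section Module

variable {E F : Type*} [AddCommGroup E] [Module ℝ E] [AddCommGroup F] [Module ℝ F] {g : E → ℝ}

lemma convexOn (h : IsNorm g) : ConvexOn ℝ Set.univ g := by
  refine ⟨convex_univ, fun u _ v _ a b ha hb _ => (h.add_le _ _).trans_eq ?_⟩
  rw [h.smul, h.smul, abs_of_nonneg ha, abs_of_nonneg hb, smul_eq_mul, smul_eq_mul]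

lemma convex_setOf_le (h : IsNorm g) (r : ℝ) : Convex ℝ {v | g v ≤ r} := by
  simpa using h.convexOn.convex_le r

lemma comp_injective (h : IsNorm g) (f : F →ₗ[ℝ] E) (hf : Function.Injective f) :
    IsNorm (g ∘ f) where
  nonneg v := h.nonneg _
  add_le u v := by simpa using h.add_le (f u) (f v)
  smul a v := by simpa using h.smul a (f v)
  eq_zero v hv := hf (by simpa using h.eq_zero _ hv)

lemma exists_norming (h : IsNorm g) {e : E} (he : e ≠ 0) :
    ∃ φ : E →ₗ[ℝ] ℝ, φ e = g e ∧ ∀ v, |φ v| ≤ g v := by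
  have hspan (c : ℝ) (hc : c • e = 0) : c • g e = 0 := by
    simp [(smul_eq_zero.1 hc).resolve_right he]
  obtain ⟨φ, hφ, hle⟩ := exists_extension_of_le_sublinear
    (LinearPMap.mkSpanSingleton' e (g e) hspan) g (fun c hc v => by rw [h.smul, abs_of_pos hc])
    h.add_le fun ⟨v, hv⟩ => by
      obtain ⟨c, rfl⟩ := Submodule.mem_span_singleton.1 hv
      rw [LinearPMap.mkSpanSingleton'_apply, RingHom.id_apply, h.smul, smul_eq_mul]
      exact mul_le_mul_of_nonneg_right (le_abs_self c) (h.nonneg e)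
  refine ⟨φ, ?_, fun v => abs_le'.2 ⟨hle v, ?_⟩⟩
  · exact (hφ ⟨e, Submodule.mem_span_singleton_self e⟩).trans
      (LinearPMap.mkSpanSingleton'_apply_self _ _ hspan _)
  · rw [← map_neg]
    exact (hle (-v)).trans_eq (by simpa using h.smul (-1) v)

end Module

variable {E : Type*} [NormedAddCommGroup E] [NormedSpace ℝ E] [FiniteDimensional ℝ E] {g : E → ℝ}

lemma continuous (h : IsNorm g) : Continuous g :=
  continuousOn_univ.1 (h.convexOn.continuousOn isOpen_univ)

lemma isGauge (h : IsNorm g) : IsGauge g where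
  continuous := h.continuous
  smul := h.smul
  pos v hv := (h.nonneg v).lt_of_ne fun h0 => hv (h.eq_zero v h0.symm)

end IsNorm

namespace IsGauge

section TopologicalSpace

variable {E : Type*} [TopologicalSpace E] [AddCommGroup E] [Module ℝ E] {g : E → ℝ}

lemma map_zero (h : IsGauge g) : g 0 = 0 := by
  simpa using h.smul 0 0

lemma map_neg (h : IsGauge g) (v : E) : g (-v) = g v := by
  simpa using h.smul (-1) v

lemma nonneg (h : IsGauge g) (v : E) : 0 ≤ g v := by
  rcases eq_or_ne v 0 with rfl | hv
  · exact h.map_zero.ge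
  · exact (h.pos v hv).le

lemma smul_of_nonneg (h : IsGauge g) {c : ℝ} (hc : 0 ≤ c) (v : E) : g (c • v) = c * g v := by
  rw [h.smul, abs_of_nonneg hc]

lemma map_div_smul_self (h : IsGauge g) {c : ℝ} (hc : 0 ≤ c) {v : E} (hv : v ≠ 0) :
    g ((c / g v) • v) = c := by
  rw [h.smul_of_nonneg (div_nonneg hc (h.nonneg v)), div_mul_cancel₀ _ (h.pos v hv).ne']

lemma smul_setOf_le (h : IsGauge g) {c : ℝ} (hc : 0 < c) (r : ℝ) :
    c • {v | g v ≤ r} = {v | g v ≤ c * r} := by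
  ext v
  rw [Set.mem_smul_set_iff_inv_smul_mem₀ hc.ne', Set.mem_ofPred_eq, Set.mem_ofPred_eq,
    h.smul_of_nonneg (inv_nonneg.2 hc.le), inv_mul_le_iff₀ hc]

end TopologicalSpace

variable {E : Type*} [NormedAddCommGroup E] [NormedSpace ℝ E] [FiniteDimensional ℝ E] {g : E → ℝ}

lemma exists_norm_le (h : IsGauge g) : ∃ c : ℝ, 0 < c ∧ ∀ v, ‖v‖ ≤ c * g v := by
  obtain ⟨m, hm, hmin⟩ := (isCompact_sphere (0 : E) 1).exists_forall_le' h.continuous.continuousOn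
    fun u hu => h.pos u (ne_zero_of_mem_unit_sphere ⟨u, hu⟩)
  refine ⟨m⁻¹, inv_pos.2 hm, fun v => ?_⟩
  rcases eq_or_ne v 0 with rfl | hv
  · simp [h.map_zero]
  have hv' := norm_pos_iff.2 hv
  have hsphere : ‖v‖⁻¹ • v ∈ Metric.sphere (0 : E) 1 := by simp [norm_smul, hv'.ne']
  have hle := hmin _ hsphere
  rw [h.smul_of_nonneg (inv_nonneg.2 hv'.le), le_inv_mul_iff₀ hv'] at hle
  rwa [le_inv_mul_iff₀ hm, mul_comm]

lemma isCompact_setOf_le (h : IsGauge g) (r : ℝ) : IsCompact {v | g v ≤ r} := by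
  obtain ⟨c, hc, hcg⟩ := h.exists_norm_le
  refine (isCompact_closedBall (0 : E) (c * r)).of_isClosed_subset
    (isClosed_le h.continuous continuous_const) fun v hv => ?_
  rw [mem_closedBall_zero_iff]
  exact (hcg v).trans (mul_le_mul_of_nonneg_left hv hc.le)

end IsGauge

lemma exists_contractive_projection {E : Type*} [NormedAddCommGroup E] [NormedSpace ℝ E]
    [FiniteDimensional ℝ E] [Nontrivial E] {g₀ g₁ : E → ℝ} (h₀ : IsNorm g₀) (h₁ : IsNorm g₁) :
    ∃ e ≠ 0, ∃ φ : E →ₗ[ℝ] ℝ, φ e = 1 ∧ (∀ v, |φ v| * g₀ e ≤ g₀ v) ∧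
      ∀ v, |φ v| * g₁ e ≤ g₁ v := by
  -- A `g₀`-norming functional at a maximiser `e` of `g₀ / g₁` is also `g₁`-norming.
  obtain ⟨e, he, hmax⟩ := (isCompact_sphere (0 : E) 1).exists_isMaxOn (f := fun v => g₀ v / g₁ v)
    (NormedSpace.sphere_nonempty.2 zero_le_one) (h₀.continuous.continuousOn.div
      h₁.continuous.continuousOn fun v hv =>
        (h₁.isGauge.pos v (ne_zero_of_mem_unit_sphere ⟨v, hv⟩)).ne')
  have he0 : e ≠ 0 := ne_zero_of_mem_unit_sphere ⟨e, he⟩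
  have hp₀ := h₀.isGauge.pos e he0
  have hp₁ := h₁.isGauge.pos e he0
  have hratio (v : E) : g₀ v * g₁ e ≤ g₁ v * g₀ e := by
    rcases eq_or_ne v 0 with rfl | hv
    · simp [h₀.isGauge.map_zero, h₁.isGauge.map_zero]
    have hle : g₀ (‖v‖⁻¹ • v) / g₁ (‖v‖⁻¹ • v) ≤ g₀ e / g₁ e :=
      hmax (by simp [norm_smul, norm_ne_zero_iff.2 hv])
    rw [h₀.smul, h₁.smul, mul_div_mul_left _ _ (by simpa using hv),
      div_le_div_iff₀ (h₁.isGauge.pos v hv) hp₁] at hle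
    rwa [mul_comm (g₁ v)]
  obtain ⟨φ, hφe, hφ⟩ := h₀.exists_norming he0
  have habs (v : E) : |((g₀ e)⁻¹ • φ) v| = |φ v| / g₀ e := by
    simp [abs_div, abs_of_pos hp₀, inv_mul_eq_div]
  refine ⟨e, he0, (g₀ e)⁻¹ • φ, by simp [hφe, hp₀.ne'], fun v => ?_, fun v => ?_⟩
  · rw [habs, div_mul_cancel₀ _ hp₀.ne']
    exact hφ v
  · rw [habs, div_mul_eq_mul_div, div_le_iff₀ hp₀]
    exact (mul_le_mul_of_nonneg_right (hφ v) hp₁.le).trans (hratio v)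

/-- The Euclidean space `ℝᵈ`. -/
abbrev Euc (d : ℕ) := EuclideanSpace ℝ (Fin d)

section Dual

variable {d : ℕ}

lemma dual_nonneg (g : Euc d → ℝ) (v : Euc d) : 0 ≤ dual g v := by
  refine Real.sSup_nonneg ?_
  rintro _ ⟨w, -, rfl⟩
  exact abs_nonneg _

namespace IsGauge

variable {g : Euc d → ℝ}

lemma abs_inner_le_dual (h : IsGauge g) (v w : Euc d) : |inner ℝ v w| ≤ dual g v * g w := by
  rcases eq_or_ne w 0 with rfl | hw
  · simp [h.map_zero]
  have hgw := h.pos w hw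
  have hbdd : BddAbove {r : ℝ | ∃ w, g w ≤ 1 ∧ r = |inner ℝ v w|} := by
    refine BddAbove.mono ?_
      ((h.isCompact_setOf_le 1).image (f := fun w => |inner ℝ v w|) (by fun_prop)).bddAbove
    rintro _ ⟨u, hu, rfl⟩
    exact ⟨u, hu, rfl⟩
  have hunit : |inner ℝ v ((1 / g w) • w)| ≤ dual g v :=
    le_csSup hbdd ⟨_, (h.map_div_smul_self zero_le_one hw).le, rfl⟩
  rwa [real_inner_smul_right, abs_mul, abs_of_pos (one_div_pos.2 hgw), one_div_mul_eq_div,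
    div_le_iff₀ hgw] at hunit

lemma dual_le (h : IsGauge g) {v : Euc d} {r : ℝ} (hr : 0 ≤ r)
    (H : ∀ w, |inner ℝ v w| ≤ r * g w) : dual g v ≤ r := by
  refine csSup_le ⟨0, 0, by simp [h.map_zero], by simp⟩ ?_
  rintro _ ⟨w, hw, rfl⟩
  exact (H w).trans (mul_le_of_le_one_right hr hw)

lemma dual_smul_le (h : IsGauge g) (a : ℝ) (v : Euc d) : dual g (a • v) ≤ |a| * dual g v := by
  refine h.dual_le (mul_nonneg (abs_nonneg a) (dual_nonneg g v)) fun w => ?_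
  rw [real_inner_smul_left, abs_mul, mul_assoc]
  exact mul_le_mul_of_nonneg_left (h.abs_inner_le_dual v w) (abs_nonneg a)

lemma isNorm_dual (h : IsGauge g) : IsNorm (dual g) where
  nonneg := dual_nonneg g
  add_le u v := by
    refine h.dual_le (add_nonneg (dual_nonneg g u) (dual_nonneg g v)) fun w => ?_
    rw [inner_add_left, add_mul]
    exact (abs_add_le _ _).trans (add_le_add (h.abs_inner_le_dual u w) (h.abs_inner_le_dual v w))
  smul a v := by
    refine (h.dual_smul_le a v).antisymm ?_
    rcases eq_or_ne a 0 with rfl | ha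
    · simpa using dual_nonneg g _
    · have hle := h.dual_smul_le a⁻¹ (a • v)
      rwa [inv_smul_smul₀ ha, abs_inv, le_inv_mul_iff₀ (abs_pos.2 ha)] at hle
  eq_zero v hv := by simpa [hv] using h.abs_inner_le_dual v v

lemma isNorm_dual_dual (h : IsGauge g) : IsNorm (dual (dual g)) :=
  h.isNorm_dual.isGauge.isNorm_dual

lemma dual_dual_le (h : IsGauge g) (v : Euc d) : dual (dual g) v ≤ g v := by
  refine h.isNorm_dual.isGauge.dual_le (h.nonneg v) fun w => ?_
  rw [real_inner_comm, mul_comm]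
  exact h.abs_inner_le_dual w v

lemma inner_le_mul_dual_dual (h : IsGauge g) {w : Euc d} {r : ℝ} (hr : 0 ≤ r)
    (H : ∀ u, inner ℝ w u ≤ r * g u) (v : Euc d) : inner ℝ w v ≤ r * dual (dual g) v := by
  have hdual : dual g w ≤ r := h.dual_le hr fun u =>
    abs_le'.2 ⟨H u, by simpa [h.map_neg] using H (-u)⟩
  calc inner ℝ w v ≤ |inner ℝ v w| := by rw [real_inner_comm]; exact le_abs_self _
    _ ≤ dual (dual g) v * dual g w := h.isNorm_dual.isGauge.abs_inner_le_dual v w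
    _ ≤ r * dual (dual g) v := by
      rw [mul_comm]
      exact mul_le_mul_of_nonneg_right hdual (dual_nonneg _ v)

end IsGauge

lemma rpow_one_sub_mul_rpow {a : ℝ} (ha : 0 ≤ a) (θ : ℝ) : a ^ (1 - θ) * a ^ θ = a := by
  rw [← Real.rpow_add' ha (by simp), sub_add_cancel, Real.rpow_one]

lemma isGauge_geomMean {g₀ g₁ : Euc d → ℝ} (h₀ : IsGauge g₀) (h₁ : IsGauge g₁) {θ : ℝ}
    (hθ₀ : 0 < θ) (hθ₁ : θ < 1) : IsGauge (geomMean θ g₀ g₁) where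
  continuous := (h₀.continuous.rpow_const fun _ => .inr (sub_nonneg.2 hθ₁.le)).mul
    (h₁.continuous.rpow_const fun _ => .inr hθ₀.le)
  smul a v := by
    simp only [geomMean]
    rw [h₀.smul, h₁.smul, Real.mul_rpow (abs_nonneg a) (h₀.nonneg v),
      Real.mul_rpow (abs_nonneg a) (h₁.nonneg v), mul_mul_mul_comm,
      rpow_one_sub_mul_rpow (abs_nonneg a)]
  pos v hv := mul_pos (Real.rpow_pos_of_pos (h₀.pos v hv) _) (Real.rpow_pos_of_pos (h₁.pos v hv) _)

variable {Ω : Type*} [MeasurableSpace Ω]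

lemma measurable_dual {g : Ω → Euc d → ℝ} (hg : ∀ x, IsGauge (g x))
    (hm : ∀ v, Measurable fun x => g x v) (v : Euc d) : Measurable fun x => dual (g x) v := by
  refine measurable_of_Iic fun r => ?_
  rcases lt_or_ge r 0 with hr | hr
  · convert MeasurableSet.empty (α := Ω)
    ext x
    simpa using hr.trans_le (dual_nonneg (g x) v)
  let w := TopologicalSpace.denseSeq (Euc d)
  have hdense : (fun x => dual (g x) v) ⁻¹' Set.Iic r =
      ⋂ i, {x | |inner ℝ v (w i)| ≤ r * g x (w i)} := by
    ext x
    simp only [Set.mem_preimage, Set.mem_Iic, Set.mem_iInter, Set.mem_ofPred_eq]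
    refine ⟨fun hle i => ((hg x).abs_inner_le_dual _ _).trans
      (mul_le_mul_of_nonneg_right hle ((hg x).nonneg _)), fun hle => (hg x).dual_le hr fun u => ?_⟩
    have hclosed : IsClosed {u : Euc d | |inner ℝ v u| ≤ r * g x u} :=
      isClosed_le (by fun_prop) (continuous_const.mul (hg x).continuous)
    exact (TopologicalSpace.denseRange_denseSeq (Euc d)).induction_on u hclosed hle
  rw [hdense]
  exact .iInter fun i => measurableSet_le measurable_const (measurable_const.mul (hm _))

namespace IsNormFunction

variable {ρ ρ₀ ρ₁ : Ω → Euc d → ℝ} {θ : ℝ}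

lemma isNorm (h : IsNormFunction ρ) (x : Ω) : IsNorm (ρ x) :=
  ⟨h.nonneg x, h.add_le x, h.smul x, h.eq_zero x⟩

lemma isGauge (h : IsNormFunction ρ) (x : Ω) : IsGauge (ρ x) :=
  (h.isNorm x).isGauge

lemma of_isNorm (h : ∀ x, IsNorm (ρ x)) (hm : ∀ v, Measurable fun x => ρ x v) : IsNormFunction ρ :=
  ⟨fun x => (h x).nonneg, fun x => (h x).add_le, fun x => (h x).smul, fun x => (h x).eq_zero, hm⟩

lemma interpNorm (h₀ : IsNormFunction ρ₀) (h₁ : IsNormFunction ρ₁) (hθ₀ : 0 < θ) (hθ₁ : θ < 1) :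
    IsNormFunction (interpNorm θ ρ₀ ρ₁) := by
  have hg x := isGauge_geomMean (h₀.isGauge x) (h₁.isGauge x) hθ₀ hθ₁
  refine .of_isNorm (fun x => (hg x).isNorm_dual_dual) (measurable_dual
    (fun x => (hg x).isNorm_dual.isGauge) (measurable_dual hg fun w => ?_))
  exact ((h₀.measurable w).pow_const _).mul ((h₁.measurable w).pow_const _)

end IsNormFunction

end Dual

section Splitting

/-- The vectors `a + b` with `g₀ a ≤ tᶿ A` and `g₁ b ≤ tᶿ⁻¹ B`: the ball at scale `t` of a
`K`-functional of `g₀` and `g₁`. -/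
def splitBall {E : Type*} [Add E] (θ : ℝ) (g₀ g₁ : E → ℝ) (A B t : ℝ) : Set E :=
  {a | g₀ a ≤ t ^ θ * A} + {b | g₁ b ≤ t ^ (θ - 1) * B}

section Duality

variable {d : ℕ} {g₀ g₁ : Euc d → ℝ} {θ : ℝ}

lemma div_geomMean_le_add {A B : ℝ} (hA : 0 ≤ A) (hB : 0 ≤ B) (hθ₀ : 0 ≤ θ) (hθ₁ : θ ≤ 1)
    {v : Euc d} (h₀ : 0 ≤ g₀ v) (h₁ : 0 ≤ g₁ v) :
    A ^ (1 - θ) * B ^ θ / geomMean θ g₀ g₁ v ≤ A / g₀ v + B / g₁ v := by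
  have hA' := div_nonneg hA h₀
  have hB' := div_nonneg hB h₁
  calc A ^ (1 - θ) * B ^ θ / geomMean θ g₀ g₁ v = (A / g₀ v) ^ (1 - θ) * (B / g₁ v) ^ θ := by
        rw [Real.div_rpow hA h₀, Real.div_rpow hB h₁, div_mul_div_comm, geomMean]
    _ ≤ (1 - θ) * (A / g₀ v) + θ * (B / g₁ v) :=
        Real.geom_mean_le_arith_mean2_weighted (sub_nonneg.2 hθ₁) hθ₀ hA' hB' (sub_add_cancel _ _)
    _ ≤ A / g₀ v + B / g₁ v := add_le_add (mul_le_of_le_one_left hA' (by linarith))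
        (mul_le_of_le_one_left hB' hθ₁)

lemma inner_mul_le_mul_geomMean_of_forall_mem (h₀ : IsGauge g₀) (h₁ : IsGauge g₁) (hθ₀ : 0 < θ)
    (hθ₁ : θ < 1) {A B u₀ : ℝ} (hA : 0 ≤ A) (hB : 0 ≤ B) {w : Euc d}
    (H : ∀ y ∈ {a | g₀ a ≤ A} + {b | g₁ b ≤ B}, inner ℝ w y ≤ u₀) (v : Euc d) :
    A ^ (1 - θ) * B ^ θ * inner ℝ w v ≤ u₀ * geomMean θ g₀ g₁ v := by
  have hg := isGauge_geomMean h₀ h₁ hθ₀ hθ₁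
  have hu₀ : 0 ≤ u₀ := by
    simpa using H (0 + 0) (Set.add_mem_add (h₀.map_zero.trans_le hA) (h₁.map_zero.trans_le hB))
  rcases eq_or_ne v 0 with rfl | hv
  · simp [hg.map_zero]
  rcases le_total (inner ℝ w v) 0 with hneg | hpos
  · exact (mul_nonpos_of_nonneg_of_nonpos (by positivity) hneg).trans
      (mul_nonneg hu₀ (hg.nonneg v))
  have hmem : (A / g₀ v) • v + (B / g₁ v) • v ∈ {a | g₀ a ≤ A} + {b | g₁ b ≤ B} :=
    Set.add_mem_add (h₀.map_div_smul_self hA hv).le (h₁.map_div_smul_self hB hv).le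
  rw [← div_le_iff₀ (hg.pos v hv), mul_div_right_comm]
  calc A ^ (1 - θ) * B ^ θ / geomMean θ g₀ g₁ v * inner ℝ w v
      ≤ (A / g₀ v + B / g₁ v) * inner ℝ w v := mul_le_mul_of_nonneg_right
        (div_geomMean_le_add hA hB hθ₀.le hθ₁.le (h₀.nonneg v) (h₁.nonneg v)) hpos
    _ ≤ u₀ := by simpa [← add_smul, real_inner_smul_right] using H _ hmem

lemma mem_add_of_dual_dual_geomMean_le (h₀ : IsNorm g₀) (h₁ : IsNorm g₁) (hθ₀ : 0 < θ)
    (hθ₁ : θ < 1) {A B : ℝ} (hA : 0 ≤ A) (hB : 0 ≤ B) {v : Euc d}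
    (hv : dual (dual (geomMean θ g₀ g₁)) v ≤ A ^ (1 - θ) * B ^ θ) :
    v ∈ {a | g₀ a ≤ A} + {b | g₁ b ≤ B} := by
  have hg := isGauge_geomMean h₀.isGauge h₁.isGauge hθ₀ hθ₁
  have hzero : (0 : Euc d) + 0 ∈ {a | g₀ a ≤ A} + {b | g₁ b ≤ B} :=
    Set.add_mem_add (h₀.isGauge.map_zero.trans_le hA) (h₁.isGauge.map_zero.trans_le hB)
  rw [add_zero] at hzero
  rcases (by positivity : 0 ≤ A ^ (1 - θ) * B ^ θ).eq_or_lt with hAB | hAB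
  · rwa [hg.isNorm_dual_dual.eq_zero v ((hAB ▸ hv).antisymm (dual_nonneg _ v))]
  -- A functional separating `v` from the sum would violate the bound on the double dual.
  by_contra hmem
  obtain ⟨φ, u₀, hu, huv⟩ := geometric_hahn_banach_closed_point
    ((h₀.convex_setOf_le _).add (h₁.convex_setOf_le _))
    ((h₀.isGauge.isCompact_setOf_le _).add (h₁.isGauge.isCompact_setOf_le _)).isClosed hmem
  obtain ⟨w, rfl⟩ := (InnerProductSpace.toDual ℝ (Euc d)).surjective φ
  simp only [InnerProductSpace.toDual_apply_apply] at hu huv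
  have hu₀ : 0 < u₀ := by simpa using hu 0 hzero
  have hw (u : Euc d) : inner ℝ w u ≤ u₀ / (A ^ (1 - θ) * B ^ θ) * geomMean θ g₀ g₁ u := by
    rw [div_mul_eq_mul_div, le_div_iff₀' hAB]
    exact inner_mul_le_mul_geomMean_of_forall_mem h₀.isGauge h₁.isGauge hθ₀ hθ₁ hA hB
      (fun y hy => (hu y hy).le) u
  refine huv.not_ge ((hg.inner_le_mul_dual_dual (by positivity) hw v).trans ?_)
  rwa [div_mul_eq_mul_div, div_le_iff₀ hAB, mul_le_mul_iff_right₀ hu₀]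

end Duality

variable {E F : Type*} [AddCommGroup E] [Module ℝ E] [AddCommGroup F] [Module ℝ F] {θ : ℝ}

lemma map_mem_splitBall {g₀ g₁ : E → ℝ} {f₀ f₁ : F → ℝ} (L : E →ₗ[ℝ] F) {c₀ c₁ A B t : ℝ}
    (hc₀ : 0 ≤ c₀) (hc₁ : 0 ≤ c₁) (h₀ : ∀ v, f₀ (L v) ≤ c₀ * g₀ v)
    (h₁ : ∀ v, f₁ (L v) ≤ c₁ * g₁ v) {v : E} (hv : v ∈ splitBall θ g₀ g₁ A B t) :
    L v ∈ splitBall θ f₀ f₁ (c₀ * A) (c₁ * B) t := by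
  obtain ⟨a, ha, b, hb, rfl⟩ := hv
  refine ⟨L a, ?_, L b, ?_, (map_add L a b).symm⟩
  · exact (h₀ a).trans ((mul_le_mul_of_nonneg_left ha hc₀).trans_eq (mul_left_comm _ _ _))
  · exact (h₁ b).trans ((mul_le_mul_of_nonneg_left hb hc₁).trans_eq (mul_left_comm _ _ _))

lemma mul_rpow_one_sub_mul_mul_rpow {c A B : ℝ} (hc : 0 ≤ c) (hA : 0 ≤ A) (hB : 0 ≤ B) :
    (c * A) ^ (1 - θ) * (c * B) ^ θ = c * (A ^ (1 - θ) * B ^ θ) := by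
  rw [Real.mul_rpow hc hA, Real.mul_rpow hc hB, mul_mul_mul_comm, rpow_one_sub_mul_rpow hc]

lemma abs_le_of_forall_mem_splitBall_abs (hθ₀ : 0 < θ) (hθ₁ : θ < 1) {x A B : ℝ} (hA : 0 < A)
    (hB : 0 < B) (H : ∀ t : ℚ, 0 < t → x ∈ splitBall θ (|·|) (|·|) A B t) :
    |x| ≤ 3 * (A ^ (1 - θ) * B ^ θ) := by
  -- The two terms balance at `t = B / A`; a rational `t` within a factor `2` of it suffices.
  set τ := B / A with hτ
  have hτ0 : 0 < τ := div_pos hB hA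
  obtain ⟨t, hτt, htτ⟩ := exists_rat_btwn (show τ < 2 * τ by linarith)
  have ht : (0 : ℝ) < t := hτ0.trans hτt
  obtain ⟨a, ha, b, hb, rfl⟩ := H t (mod_cast ht)
  have hτA : τ ^ θ * A = A ^ (1 - θ) * B ^ θ := by
    rw [hτ, Real.div_rpow hB.le hA.le, Real.rpow_sub hA, Real.rpow_one]
    ring
  have hτB : τ ^ (θ - 1) * B = A ^ (1 - θ) * B ^ θ := by
    rw [← hτA, Real.rpow_sub hτ0, Real.rpow_one, hτ]
    field_simp
  have htwo : (2 : ℝ) ^ θ ≤ 2 := by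
    simpa using Real.rpow_le_rpow_of_exponent_le one_le_two hθ₁.le
  calc |a + b| ≤ |a| + |b| := abs_add_le a b
    _ ≤ t ^ θ * A + t ^ (θ - 1) * B := add_le_add ha hb
    _ ≤ (2 * τ) ^ θ * A + τ ^ (θ - 1) * B := by
      gcongr ?_ * A + ?_ * B
      · exact Real.rpow_le_rpow ht.le htτ.le hθ₀.le
      · exact Real.rpow_le_rpow_of_nonpos hτ0 hτt.le (by linarith)
    _ ≤ 2 * (τ ^ θ * A) + τ ^ (θ - 1) * B := by
      rw [Real.mul_rpow zero_le_two hτ0.le, mul_assoc]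
      gcongr
    _ = 3 * (A ^ (1 - θ) * B ^ θ) := by rw [hτA, hτB]; ring

lemma apply_smul_le_of_forall_mem_splitBall (hθ₀ : 0 < θ) (hθ₁ : θ < 1) {g₀ g₁ N : E → ℝ}
    (hN : IsNorm N) (hle : ∀ v, N v ≤ g₀ v ^ (1 - θ) * g₁ v ^ θ) {e : E} (he₀ : 0 < g₀ e)
    (he₁ : 0 < g₁ e) {φ : E →ₗ[ℝ] ℝ} (hφ₀ : ∀ v, |φ v| * g₀ e ≤ g₀ v)
    (hφ₁ : ∀ v, |φ v| * g₁ e ≤ g₁ v) {A B : ℝ} (hA : 0 < A) (hB : 0 < B) {v : E}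
    (H : ∀ t : ℚ, 0 < t → v ∈ splitBall θ g₀ g₁ A B t) :
    N (φ v • e) ≤ 3 * (A ^ (1 - θ) * B ^ θ) := by
  have hcoef : |φ v| ≤ 3 * (((g₀ e)⁻¹ * A) ^ (1 - θ) * ((g₁ e)⁻¹ * B) ^ θ) :=
    abs_le_of_forall_mem_splitBall_abs hθ₀ hθ₁ (by positivity) (by positivity) fun t ht =>
      map_mem_splitBall φ (by positivity) (by positivity)
        (fun u => (le_inv_mul_iff₀' he₀).2 (hφ₀ u)) (fun u => (le_inv_mul_iff₀' he₁).2 (hφ₁ u))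
        (H t ht)
  rw [hN.smul]
  calc |φ v| * N e
      ≤ 3 * (((g₀ e)⁻¹ * A) ^ (1 - θ) * ((g₁ e)⁻¹ * B) ^ θ) * (g₀ e ^ (1 - θ) * g₁ e ^ θ) :=
        mul_le_mul hcoef (hle e) (hN.nonneg e) (by positivity)
    _ = 3 * ((g₀ e * ((g₀ e)⁻¹ * A)) ^ (1 - θ) * (g₁ e * ((g₁ e)⁻¹ * B)) ^ θ) := by
        rw [Real.mul_rpow he₀.le (by positivity), Real.mul_rpow he₁.le (by positivity)]
        ring
    _ = 3 * (A ^ (1 - θ) * B ^ θ) := by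
        rw [mul_inv_cancel_left₀ he₀.ne', mul_inv_cancel_left₀ he₁.ne']

/-- The complement `v ↦ v - φ v • e` of a rank-one projection, as a map onto the kernel of `φ`. -/
def projKer (φ : E →ₗ[ℝ] ℝ) {e : E} (he : φ e = 1) : E →ₗ[ℝ] LinearMap.ker φ :=
  (LinearMap.id - φ.smulRight e).codRestrict _ fun v => by simp [he]

lemma coe_projKer (φ : E →ₗ[ℝ] ℝ) {e : E} (he : φ e = 1) (v : E) :
    (projKer φ he v : E) = v - φ v • e := rfl

lemma IsNorm.apply_projKer_le {g : E → ℝ} (hg : IsNorm g) {φ : E →ₗ[ℝ] ℝ} {e : E} (he : φ e = 1)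
    (hφ : ∀ v, |φ v| * g e ≤ g v) (v : E) : g (projKer φ he v) ≤ 2 * g v := by
  calc g (projKer φ he v) = g (v + (-φ v) • e) := by rw [coe_projKer, neg_smul, sub_eq_add_neg]
    _ ≤ g v + |φ v| * g e := (hg.add_le _ _).trans_eq (by rw [hg.smul, abs_neg])
    _ ≤ 2 * g v := by linarith [hφ v]

/-- Splitting off a rank-one projection that is contractive in both norms leaves the same problem on
its kernel, at the cost of a factor `2`. -/
theorem IsNorm.le_of_forall_mem_splitBall (hθ₀ : 0 < θ) (hθ₁ : θ < 1) (n : ℕ) :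
    ∀ {E : Type*} [NormedAddCommGroup E] [NormedSpace ℝ E] [FiniteDimensional ℝ E]
      {g₀ g₁ N : E → ℝ} {A B : ℝ} {v : E}, Module.finrank ℝ E = n → IsNorm g₀ → IsNorm g₁ →
      IsNorm N → (∀ u, N u ≤ g₀ u ^ (1 - θ) * g₁ u ^ θ) → 0 < A → 0 < B →
      (∀ t : ℚ, 0 < t → v ∈ splitBall θ g₀ g₁ A B t) →
      N v ≤ 3 * (2 ^ n - 1) * (A ^ (1 - θ) * B ^ θ) := by
  induction n with
  | zero =>
    intro E _ _ _ g₀ g₁ N A B v hn _ _ hN _ _ _ _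
    have := Module.finrank_zero_iff.1 hn
    simp [Subsingleton.elim v 0, hN.isGauge.map_zero]
  | succ n ih =>
    intro E _ _ _ g₀ g₁ N A B v hn h₀ h₁ hN hle hA hB H
    have : Nontrivial E := Module.nontrivial_of_finrank_eq_succ hn
    obtain ⟨e, he, φ, hφe, hφ₀, hφ₁⟩ := exists_contractive_projection h₀ h₁
    have hker : Module.finrank ℝ (LinearMap.ker φ) = n := by
      have hφ : Function.Surjective φ := fun r => ⟨r • e, by simp [hφe]⟩
      have := φ.finrank_range_add_finrank_ker
      rw [LinearMap.range_eq_top.2 hφ, finrank_top, Module.finrank_self, hn] at this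
      omega
    have hinj := (LinearMap.ker φ).injective_subtype
    have hrest := ih hker (h₀.comp_injective _ hinj) (h₁.comp_injective _ hinj)
      (hN.comp_injective _ hinj) (fun u => hle u) (mul_pos two_pos hA) (mul_pos two_pos hB)
      fun t ht => map_mem_splitBall (projKer φ hφe) zero_le_two zero_le_two
        (h₀.apply_projKer_le hφe hφ₀) (h₁.apply_projKer_le hφe hφ₁) (H t ht)
    rw [mul_rpow_one_sub_mul_mul_rpow zero_le_two hA.le hB.le] at hrest
    calc N v = N (projKer φ hφe v + φ v • e) := by rw [coe_projKer, sub_add_cancel]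
      _ ≤ N (projKer φ hφe v) + N (φ v • e) := hN.add_le _ _
      _ ≤ 3 * (2 ^ n - 1) * (2 * (A ^ (1 - θ) * B ^ θ)) + 3 * (A ^ (1 - θ) * B ^ θ) :=
        add_le_add hrest (apply_smul_le_of_forall_mem_splitBall hθ₀ hθ₁ hN hle
          (h₀.isGauge.pos e he) (h₁.isGauge.pos e he) hφ₀ hφ₁ hA hB H)
      _ = 3 * (2 ^ (n + 1) - 1) * (A ^ (1 - θ) * B ^ θ) := by ring

lemma dual_dual_geomMean_le_of_forall_mem_splitBall {d : ℕ} {g₀ g₁ : Euc d → ℝ} (h₀ : IsNorm g₀)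
    (h₁ : IsNorm g₁) (hθ₀ : 0 < θ) (hθ₁ : θ < 1) {A B : ℝ} (hA : 0 ≤ A) (hB : 0 ≤ B) {v : Euc d}
    (H : ∀ t : ℚ, 0 < t → v ∈ splitBall θ g₀ g₁ A B t) :
    dual (dual (geomMean θ g₀ g₁)) v ≤ 3 * 2 ^ d * (A ^ (1 - θ) * B ^ θ) := by
  have hg := isGauge_geomMean h₀.isGauge h₁.isGauge hθ₀ hθ₁
  have hpos (ε : ℝ) (hε : 0 < ε) : dual (dual (geomMean θ g₀ g₁)) v ≤
      3 * 2 ^ d * ((A + ε) ^ (1 - θ) * (B + ε) ^ θ) := by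
    refine (IsNorm.le_of_forall_mem_splitBall hθ₀ hθ₁ d (by simp) h₀ h₁ hg.isNorm_dual_dual
      hg.dual_dual_le (by positivity) (by positivity) fun t ht => ?_).trans
      (mul_le_mul_of_nonneg_right (by linarith) (by positivity))
    have : (0 : ℝ) < t := mod_cast ht
    have hε' (r : ℝ) : r ≤ r + ε := le_add_of_nonneg_right hε.le
    exact Set.add_subset_add
      (fun a ha => le_trans ha (mul_le_mul_of_nonneg_left (hε' A) (by positivity)))
      (fun b hb => le_trans hb (mul_le_mul_of_nonneg_left (hε' B) (by positivity))) (H t ht)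
  have hcont : Continuous fun ε : ℝ => 3 * 2 ^ d * ((A + ε) ^ (1 - θ) * (B + ε) ^ θ) := by
    have := sub_nonneg.2 hθ₁.le
    fun_prop (disch := simp [*, hθ₀.le])
  have hlim := (hcont.tendsto 0).mono_left (nhdsWithin_le_nhds (s := Set.Ioi 0))
  simp only [add_zero] at hlim
  exact ge_of_tendsto hlim (Filter.eventually_of_mem self_mem_nhdsWithin hpos)

end Splitting

section Kbcs

variable {d : ℕ} {g : Euc d → ℝ} {S S' : Set (Euc d)}

namespace IsKbcs

lemma isCompact (h : IsKbcs S) : IsCompact S :=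
  Metric.isCompact_of_isClosed_isBounded h.isClosed h.isBounded

lemma neg_mem (h : IsKbcs S) {v : Euc d} (hv : v ∈ S) : -v ∈ S := by
  rwa [← Set.mem_neg, h.symmetric]

lemma zero_mem (h : IsKbcs S) : (0 : Euc d) ∈ S := by
  obtain ⟨v, hv⟩ := h.nonempty
  simpa using h.convex.midpoint_mem hv (h.neg_mem hv)

lemma zero : IsKbcs (0 : Set (Euc d)) where
  nonempty := Set.zero_nonempty
  isClosed := isClosed_singleton
  isBounded := Bornology.isBounded_singleton
  convex := convex_singleton 0
  symmetric := neg_zero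

lemma add (h : IsKbcs S) (h' : IsKbcs S') : IsKbcs (S + S') where
  nonempty := h.nonempty.add h'.nonempty
  isClosed := (h.isCompact.add h'.isCompact).isClosed
  isBounded := (h.isCompact.add h'.isCompact).isBounded
  convex := h.convex.add h'.convex
  symmetric := by rw [neg_add, h.symmetric, h'.symmetric]

lemma smul (h : IsKbcs S) (c : ℝ) : IsKbcs (c • S) where
  nonempty := h.nonempty.smul_set
  isClosed := (h.isCompact.smul c).isClosed
  isBounded := (h.isCompact.smul c).isBounded
  convex := h.convex.smul c
  symmetric := by rw [← Set.smul_set_neg, h.symmetric]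

lemma smul_subset_smul (h : IsKbcs S) {a b : ℝ} (ha : 0 ≤ a) (hab : a ≤ b) : a • S ⊆ b • S := by
  rcases (ha.trans hab).eq_or_lt with rfl | hb
  · rw [hab.antisymm ha]
  rintro _ ⟨v, hv, rfl⟩
  rw [Set.mem_smul_set_iff_inv_smul_mem₀ hb.ne', smul_smul]
  exact h.convex.smul_mem_of_zero_mem h.zero_mem hv
    ⟨by positivity, (inv_mul_le_one₀ hb).2 hab⟩

lemma subset_add_left (h' : IsKbcs S') : S ⊆ S + S' :=
  Set.subset_add_left S h'.zero_mem

lemma subset_add_right (h : IsKbcs S) : S' ⊆ S + S' :=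
  Set.subset_add_right S' h.zero_mem

lemma closure_iUnion {S : ℕ → Set (Euc d)} (h : ∀ k, IsKbcs (S k)) (hmono : Monotone S)
    (hb : Bornology.IsBounded (⋃ k, S k)) : IsKbcs (closure (⋃ k, S k)) where
  nonempty := ⟨0, subset_closure (Set.mem_iUnion.2 ⟨0, (h 0).zero_mem⟩)⟩
  isClosed := isClosed_closure
  isBounded := hb.closure
  convex := (hmono.directed_le.convex_iUnion fun k => (h k).convex).closure
  symmetric := by
    rw [neg_closure, Set.iUnion_neg]
    simp only [(h _).symmetric]

end IsKbcs

lemma IsNorm.isKbcs_setOf_le (h : IsNorm g) {r : ℝ} (hr : 0 ≤ r) : IsKbcs {v | g v ≤ r} where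
  nonempty := ⟨0, h.isGauge.map_zero.trans_le hr⟩
  isClosed := (h.isGauge.isCompact_setOf_le r).isClosed
  isBounded := (h.isGauge.isCompact_setOf_le r).isBounded
  convex := h.convex_setOf_le r
  symmetric := by
    ext v
    simp [h.isGauge.map_neg]

lemma isNorm_norm {E : Type*} [NormedAddCommGroup E] [NormedSpace ℝ E] :
    IsNorm fun v : E => ‖v‖ where
  nonneg := norm_nonneg
  add_le := norm_add_le
  smul a v := by rw [norm_smul, Real.norm_eq_abs]
  eq_zero _ := norm_eq_zero.1

lemma supOn_le_iff {c : ℝ≥0∞} : supOn g S ≤ c ↔ ∀ v ∈ S, ENNReal.ofReal (g v) ≤ c :=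
  iSup₂_le_iff

lemma le_supOn {v : Euc d} (hv : v ∈ S) : ENNReal.ofReal (g v) ≤ supOn g S :=
  supOn_le_iff.1 le_rfl v hv

lemma le_toReal_supOn (hS : supOn g S ≠ ∞) {v : Euc d} (hv : v ∈ S) : g v ≤ (supOn g S).toReal :=
  (ENNReal.ofReal_le_iff_le_toReal hS).1 (le_supOn hv)

lemma supOn_mono (h : S ⊆ S') : supOn g S ≤ supOn g S' :=
  biSup_mono h

lemma supOn_closure_iUnion {ι : Type*} (hg : Continuous g) (S : ι → Set (Euc d)) :
    supOn g (closure (⋃ k, S k)) = ⨆ k, supOn g (S k) := by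
  refine le_antisymm (supOn_le_iff.2 fun v hv => ?_)
    (iSup_le fun k => supOn_mono ((Set.subset_iUnion S k).trans subset_closure))
  refine closure_minimal (t := {v | ENNReal.ofReal (g v) ≤ ⨆ k, supOn g (S k)})
    (Set.iUnion_subset fun k u hu => ?_)
    (isClosed_le (ENNReal.continuous_ofReal.comp hg) continuous_const) hv
  exact (le_supOn hu).trans (le_iSup (fun k => supOn g (S k)) k)

namespace IsGauge

lemma supOn_lt_top (h : IsGauge g) (hS : Bornology.IsBounded S) : supOn g S < ∞ := by
  obtain ⟨C, hC⟩ := (hS.isCompact_closure.image h.continuous).bddAbove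
  exact (supOn_le_iff.2 fun v hv => ENNReal.ofReal_le_ofReal
    (hC ⟨v, subset_closure hv, rfl⟩)).trans_lt ENNReal.ofReal_lt_top

lemma isBounded_of_supOn_lt_top (h : IsGauge g) (hS : supOn g S < ∞) : Bornology.IsBounded S :=
  (h.isCompact_setOf_le _).isBounded.subset fun _ hv => le_toReal_supOn hS.ne hv

lemma subset_zero_of_supOn_eq_zero (h : IsGauge g) (hS : supOn g S = 0) : S ⊆ 0 := by
  intro v hv
  by_contra hv0
  exact ((le_supOn hv).trans_eq hS).not_gt (ENNReal.ofReal_pos.2 (h.pos v hv0))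

end IsGauge

/-- The largest Euclidean norm of an element of `S`; it is finite on bounded sets. -/
noncomputable def radius (S : Set (Euc d)) : ℝ := (supOn (‖·‖) S).toReal

lemma radius_nonneg (S : Set (Euc d)) : 0 ≤ radius S := ENNReal.toReal_nonneg

lemma IsKbcs.norm_le_radius (hS : IsKbcs S) {v : Euc d} (hv : v ∈ S) : ‖v‖ ≤ radius S :=
  le_toReal_supOn (g := (‖·‖)) (isNorm_norm.isGauge.supOn_lt_top hS.isBounded).ne hv

lemma radius_le {r : ℝ} (hr : 0 ≤ r) (h : ∀ v ∈ S, ‖v‖ ≤ r) : radius S ≤ r :=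
  ENNReal.toReal_le_of_le_ofReal hr (supOn_le_iff.2 fun v hv => ENNReal.ofReal_le_ofReal (h v hv))

lemma IsKbcs.radius_smul_le (hS : IsKbcs S) (c : ℝ) : radius (c • S) ≤ |c| * radius S := by
  refine radius_le (mul_nonneg (abs_nonneg c) (radius_nonneg _)) ?_
  rintro _ ⟨v, hv, rfl⟩
  rw [norm_smul, Real.norm_eq_abs]
  exact mul_le_mul_of_nonneg_left (hS.norm_le_radius hv) (abs_nonneg c)

end Kbcs

section Measurability

open TopologicalSpace

variable {d : ℕ} {Ω : Type*} [MeasurableSpace Ω] {F G : Ω → Set (Euc d)}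

namespace SetMeasurable

lemma add (hF : SetMeasurable F) (hG : SetMeasurable G) : SetMeasurable fun x => F x + G x := by
  intro U hU
  have hbasis := (isBasis_countableBasis (Euc d)).prod (isBasis_countableBasis (Euc d))
  obtain ⟨R, hR, hUR⟩ := hbasis.open_eq_sUnion (hU.preimage continuous_add)
  have hRcount : R.Countable :=
    ((countable_countableBasis _).image2 (countable_countableBasis _) _).mono hR
  have hset : {x | ((F x + G x) ∩ U).Nonempty} = ⋃ r ∈ R, {x | (F x ×ˢ G x ∩ r).Nonempty} := by
    ext x
    rw [Set.mem_ofPred_eq, ← Set.add_image_prod, Set.image_inter_nonempty_iff, hUR,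
      Set.sUnion_eq_biUnion, Set.inter_iUnion₂]
    simp only [Set.nonempty_iUnion, Set.mem_iUnion, Set.mem_ofPred_eq]
  rw [hset]
  refine .biUnion hRcount fun r hr => ?_
  obtain ⟨U₁, hU₁, U₂, hU₂, rfl⟩ := hR hr
  simp only [Set.prod_inter_prod, Set.prod_nonempty_iff]
  exact (hF _ (isOpen_of_mem_countableBasis hU₁)).inter (hG _ (isOpen_of_mem_countableBasis hU₂))

lemma indicator {A : Set Ω} (hF : SetMeasurable F) (hA : MeasurableSet A) :
    SetMeasurable (A.indicator F) := by
  intro U hU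
  have hset : {x | (A.indicator F x ∩ U).Nonempty} =
      A.ite {x | (F x ∩ U).Nonempty} {_x | ((0 : Set (Euc d)) ∩ U).Nonempty} := by
    ext x
    by_cases hx : x ∈ A <;> simp [Set.ite, hx]
  rw [hset]
  exact hA.ite (hF U hU) (.const _)

lemma smul (hF : SetMeasurable F) (c : ℝ) : SetMeasurable fun x => c • F x := fun U hU => by
  simpa only [← Set.image_smul, Set.image_inter_nonempty_iff]
    using hF _ (hU.preimage (continuous_const_smul c))

lemma natCast_smul (hF : SetMeasurable F) {N : Ω → ℕ} (hN : Measurable N) :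
    SetMeasurable fun x => (N x : ℝ) • F x := by
  intro U hU
  have hset : {x | (((N x : ℝ) • F x) ∩ U).Nonempty} =
      ⋃ n : ℕ, (N ⁻¹' {n} ∩ {x | (((n : ℝ) • F x) ∩ U).Nonempty}) := by
    ext x
    simp
  rw [hset]
  exact .iUnion fun n => (hN (measurableSet_singleton n)).inter (hF.smul n U hU)

lemma closure_iUnion {ι : Type*} [Countable ι] {F : ι → Ω → Set (Euc d)}
    (hF : ∀ k, SetMeasurable (F k)) : SetMeasurable fun x => closure (⋃ k, F k x) := by
  intro U hU
  simp only [closure_inter_open_nonempty_iff hU, Set.iUnion_inter, Set.nonempty_iUnion]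
  simpa only [Set.ofPred_exists] using MeasurableSet.iUnion fun k => hF k U hU

end SetMeasurable

/-- The pointwise balls `{v | ρ x v ≤ r x}`, as a set-valued function. -/
def normBall (ρ : Ω → Euc d → ℝ) (r : Ω → ℝ) : Ω → Set (Euc d) := fun x => {v | ρ x v ≤ r x}

omit [MeasurableSpace Ω] in
lemma supOn_normBall_le (ρ : Ω → Euc d → ℝ) (r : Ω → ℝ) (x : Ω) :
    supOn (ρ x) (normBall ρ r x) ≤ ENNReal.ofReal (r x) :=
  supOn_le_iff.2 fun _ hv => ENNReal.ofReal_le_ofReal hv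

lemma IsGauge.setOf_le_subset_closure_setOf_lt {E : Type*} [TopologicalSpace E] [AddCommGroup E]
    [Module ℝ E] [ContinuousSMul ℝ E] {g : E → ℝ} (h : IsGauge g) {r : ℝ} (hr : 0 < r) :
    {v | g v ≤ r} ⊆ closure {v | g v < r} := by
  intro v hv
  have hlim : Filter.Tendsto (fun a : ℝ => a • v) (nhdsWithin 1 (Set.Iio 1)) (nhds v) := by
    have hcont : Continuous fun a : ℝ => a • v := by fun_prop
    simpa using (hcont.tendsto 1).mono_left nhdsWithin_le_nhds
  refine mem_closure_of_tendsto hlim ?_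
  filter_upwards [self_mem_nhdsWithin, mem_nhdsWithin_of_mem_nhds (lt_mem_nhds one_pos)]
    with a ha1 ha0
  calc g (a • v) = a * g v := h.smul_of_nonneg ha0.le v
    _ ≤ a * r := mul_le_mul_of_nonneg_left hv ha0.le
    _ < r := mul_lt_of_lt_one_left hr ha1

lemma supOn_eq_iSup_countableBasis {g : Euc d → ℝ} (hg : Continuous g) (S : Set (Euc d)) :
    supOn g S = ⨆ U ∈ countableBasis (Euc d), ⨆ _ : (S ∩ U).Nonempty,
      ⨅ w ∈ U, ENNReal.ofReal (g w) := by
  refine le_antisymm (supOn_le_iff.2 fun v hv => le_of_forall_lt fun c hcv => ?_)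
    (iSup₂_le fun U _ => iSup_le fun ⟨v, hv, hvU⟩ => (iInf₂_le v hvU).trans (le_supOn hv))
  obtain ⟨c', hcc', hc'v⟩ := exists_between hcv
  have hopen : IsOpen {w | c' < ENNReal.ofReal (g w)} :=
    isOpen_lt continuous_const (ENNReal.continuous_ofReal.comp hg)
  obtain ⟨U, hU, hvU, hUsub⟩ :=
    (isBasis_countableBasis (Euc d)).exists_subset_of_mem_open hc'v hopen
  exact hcc'.trans_le (le_iSup₂_of_le U hU (le_iSup_of_le ⟨v, hv, hvU⟩
    (le_iInf₂ fun w hw => (hUsub hw).le)))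

lemma biInf_eq_iInf_denseSeq {E : Type*} [TopologicalSpace E] [SeparableSpace E] [Nonempty E]
    {f : E → ℝ≥0∞} (hf : Continuous f) {U : Set E} (hU : IsOpen U) :
    ⨅ w ∈ U, f w = ⨅ i ∈ denseSeq E ⁻¹' U, f (denseSeq E i) := by
  refine le_antisymm (le_iInf₂ fun i hi => iInf₂_le (denseSeq E i) hi)
    (le_iInf₂ fun w hw => le_of_forall_gt fun c hcw => ?_)
  obtain ⟨i, hiU, hic⟩ := (denseRange_denseSeq E).exists_mem_open
    (hU.inter (isOpen_lt hf continuous_const)) ⟨w, hw, hcw⟩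
  exact (iInf₂_le i hiU).trans_lt hic

namespace IsNormFunction

variable {ρ : Ω → Euc d → ℝ}

lemma measurable_supOn (hρ : IsNormFunction ρ) (hF : SetMeasurable F) :
    Measurable fun x => supOn (ρ x) (F x) := by
  have hsup (x : Ω) := supOn_eq_iSup_countableBasis (hρ.isNorm x).continuous (F x)
  simp only [hsup]
  refine .biSup _ (countable_countableBasis _) fun U hU => ?_
  have hUo := isOpen_of_mem_countableBasis hU
  have hinf : Measurable fun x => ⨅ w ∈ U, ENNReal.ofReal (ρ x w) := by
    have hdense (x : Ω) := biInf_eq_iInf_denseSeq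
      (ENNReal.continuous_ofReal.comp (hρ.isNorm x).continuous) hUo
    simp only [Function.comp_apply] at hdense
    simp only [hdense]
    exact .biInf _ (Set.to_countable _) fun i _ => (hρ.measurable _).ennreal_ofReal
  convert hinf.indicator (hF U hUo) using 2 with x
  by_cases hx : (F x ∩ U).Nonempty <;> simp [hx]

lemma setMeasurable_normBall (hρ : IsNormFunction ρ) {r : Ω → ℝ} (hr : Measurable r)
    (hr0 : ∀ x, 0 ≤ r x) : SetMeasurable (normBall ρ r) := by
  intro U hU
  by_cases h0 : (0 : Euc d) ∈ U
  · convert MeasurableSet.univ (α := Ω)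
    exact Set.eq_univ_of_forall fun x => ⟨0, (hρ.isGauge x).map_zero.trans_le (hr0 x), h0⟩
  have hset : {x | (normBall ρ r x ∩ U).Nonempty} =
      ⋃ i ∈ denseSeq (Euc d) ⁻¹' U, {x | ρ x (denseSeq (Euc d) i) < r x} := by
    ext x
    simp only [Set.mem_iUnion, Set.mem_ofPred_eq, exists_prop]
    refine ⟨fun ⟨v, hv, hvU⟩ => ?_, fun ⟨i, hi, hlt⟩ => ⟨_, hlt.le, hi⟩⟩
    have hpos : 0 < r x := ((hρ.isGauge x).pos v fun hv0 => h0 (hv0 ▸ hvU)).trans_le hv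
    have hne : ({v | ρ x v < r x} ∩ U).Nonempty := (closure_inter_open_nonempty_iff hU).1
      ⟨v, (hρ.isGauge x).setOf_le_subset_closure_setOf_lt hpos hv, hvU⟩
    obtain ⟨i, hlt, hi⟩ := (denseRange_denseSeq (Euc d)).exists_mem_open
      ((isOpen_lt (hρ.isNorm x).continuous continuous_const).inter hU) hne
    exact ⟨i, hi, hlt⟩
  rw [hset]
  exact .biUnion (Set.to_countable _) fun i _ => measurableSet_lt (hρ.measurable _) hr

lemma isKbcsFun_normBall (hρ : IsNormFunction ρ) {r : Ω → ℝ} (hr : Measurable r)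
    (hr0 : ∀ x, 0 ≤ r x) : IsKbcsFun (normBall ρ r) :=
  ⟨fun x => (hρ.isNorm x).isKbcs_setOf_le (hr0 x), hρ.setMeasurable_normBall hr hr0⟩

end IsNormFunction

lemma SetMeasurable.measurable_radius (hF : SetMeasurable F) : Measurable fun x => radius (F x) :=
  ((IsNormFunction.of_isNorm (fun _ : Ω => isNorm_norm) fun _ => measurable_const).measurable_supOn
    hF).ennreal_toReal

namespace IsKbcsFun

lemma add (hF : IsKbcsFun F) (hG : IsKbcsFun G) : IsKbcsFun fun x => F x + G x :=
  ⟨fun x => (hF.isKbcs x).add (hG.isKbcs x), hF.measurable.add hG.measurable⟩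

lemma smul (hF : IsKbcsFun F) (c : ℝ) : IsKbcsFun fun x => c • F x :=
  ⟨fun x => (hF.isKbcs x).smul c, hF.measurable.smul c⟩

lemma natCast_smul (hF : IsKbcsFun F) {N : Ω → ℕ} (hN : Measurable N) :
    IsKbcsFun fun x => (N x : ℝ) • F x :=
  ⟨fun x => (hF.isKbcs x).smul _, hF.measurable.natCast_smul hN⟩

lemma indicator (hF : IsKbcsFun F) {A : Set Ω} (hA : MeasurableSet A) :
    IsKbcsFun (A.indicator F) :=
  ⟨fun x => (Set.indicator_eq_zero_or_self A F x).elim (fun h => h ▸ .zero)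
    fun h => h ▸ hF.isKbcs x,
    hF.measurable.indicator hA⟩

lemma indicator_mono (hF : IsKbcsFun F) {A B : Set Ω} (hAB : A ⊆ B) (x : Ω) :
    A.indicator F x ⊆ B.indicator F x := by
  by_cases hx : x ∈ A
  · simp [hx, hAB hx]
  · by_cases hx' : x ∈ B <;> simp [hx, hx', (hF.isKbcs x).zero_mem]

lemma indicator_subset (hF : IsKbcsFun F) (A : Set Ω) (x : Ω) : A.indicator F x ⊆ F x := by
  simpa using hF.indicator_mono (Set.subset_univ A) x

end IsKbcsFun

end Measurability

section LocIntBdd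

variable {d : ℕ} {Ω : Type*} [TopologicalSpace Ω] [MeasurableSpace Ω] {μ : Measure Ω}
  {F G : Ω → Set (Euc d)}

lemma IsKbcsFun.mem_locIntBdd (hF : IsKbcsFun F)
    (h : LocallyIntegrable (fun x => radius (F x)) μ) : F ∈ LocIntBdd μ d :=
  ⟨hF, _, fun _ => radius_nonneg _, h, .of_forall fun x v hv => by
    simpa using (hF.isKbcs x).norm_le_radius hv⟩

lemma locallyIntegrable_radius (hF : F ∈ LocIntBdd μ d) :
    LocallyIntegrable (fun x => radius (F x)) μ := by
  obtain ⟨hF, k, hk0, hk, hFk⟩ := hF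
  refine hk.mono hF.measurable.measurable_radius.aestronglyMeasurable ?_
  filter_upwards [hFk] with x hx
  rw [Real.norm_of_nonneg (radius_nonneg _), Real.norm_of_nonneg (hk0 x)]
  exact radius_le (hk0 x) fun v hv => by simpa using hx hv

lemma IsKbcsFun.mem_locIntBdd_of_subset (hF : IsKbcsFun F) (hG : G ∈ LocIntBdd μ d)
    (h : ∀ x, F x ⊆ G x) : F ∈ LocIntBdd μ d := by
  obtain ⟨-, k, hk0, hk, hGk⟩ := hG
  exact ⟨hF, k, hk0, hk, hGk.mono fun x hx => (h x).trans hx⟩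

lemma add_mem_locIntBdd (hF : F ∈ LocIntBdd μ d) (hG : G ∈ LocIntBdd μ d) :
    (fun x => F x + G x) ∈ LocIntBdd μ d := by
  obtain ⟨hF, k, hk0, hk, hFk⟩ := hF
  obtain ⟨hG, l, hl0, hl, hGl⟩ := hG
  refine ⟨hF.add hG, k + l, fun x => add_nonneg (hk0 x) (hl0 x), hk.add hl, ?_⟩
  filter_upwards [hFk, hGl] with x hx hx'
  refine (Set.add_subset_add hx hx').trans ?_
  rw [closedBall_add_closedBall (hk0 x) (hl0 x), add_zero, Pi.add_apply]

lemma smul_mem_locIntBdd (hF : F ∈ LocIntBdd μ d) (c : ℝ) :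
    (fun x => c • F x) ∈ LocIntBdd μ d := by
  obtain ⟨hF, k, hk0, hk, hFk⟩ := hF
  refine ⟨hF.smul c, |c| • k, fun x => mul_nonneg (abs_nonneg c) (hk0 x), hk.smul |c|, ?_⟩
  filter_upwards [hFk] with x hx
  refine (Set.smul_set_mono hx).trans ?_
  rw [smul_closedBall _ _ (hk0 x), smul_zero, Real.norm_eq_abs, Pi.smul_apply, smul_eq_mul]

lemma indicator_mem_locIntBdd (hF : F ∈ LocIntBdd μ d) {A : Set Ω} (hA : MeasurableSet A) :
    A.indicator F ∈ LocIntBdd μ d :=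
  (hF.1.indicator hA).mem_locIntBdd_of_subset hF (hF.1.indicator_subset A)

lemma IsKbcsFun.indicator_radius_le_mem_locIntBdd (hF : IsKbcsFun F) {g : Ω → ℝ}
    (hgm : Measurable g) (hg0 : ∀ x, 0 ≤ g x) (hg : LocallyIntegrable g μ) :
    {x | radius (F x) ≤ g x}.indicator F ∈ LocIntBdd μ d := by
  refine ⟨hF.indicator (measurableSet_le hF.measurable.measurable_radius hgm), g, hg0, hg,
    .of_forall fun x v hv => ?_⟩
  rw [mem_closedBall_zero_iff]
  by_cases hx : radius (F x) ≤ g x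
  · rw [Set.indicator_of_mem (Set.mem_ofPred_eq ▸ hx)] at hv
    exact ((hF.isKbcs x).norm_le_radius hv).trans hx
  · rw [Set.indicator_of_notMem (Set.mem_ofPred_eq ▸ hx)] at hv
    simpa [Set.mem_zero.1 hv] using hg0 x

end LocIntBdd

section MonotoneOperator

lemma exists_strictMono_tsum_measure_ne_top {α : Type*} [MeasurableSpace α] {ν : ℕ → Measure α}
    [∀ i, IsFiniteMeasure (ν i)] {B : ℕ → Set α} (hB : Antitone B)
    (hBm : ∀ k, MeasurableSet (B k)) (hB0 : ∀ i, ν i (⋂ k, B k) = 0) :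
    ∃ φ : ℕ → ℕ, StrictMono φ ∧ ∀ i, ∑' j, ν i (B (φ j)) ≠ ∞ := by
  have hlim (i : ℕ) : Filter.Tendsto (fun n => ν i (B n)) Filter.atTop (nhds 0) := by
    rw [← hB0 i]
    exact tendsto_measure_iInter_atTop (fun k => (hBm k).nullMeasurableSet) hB
      ⟨0, measure_ne_top _ _⟩
  have hsmall (j : ℕ) : ∀ᶠ n in Filter.atTop, ∀ i ∈ Finset.range (j + 1),
      ν i (B n) ≤ 2⁻¹ ^ j :=
    (Filter.eventually_all_finset _).2 fun i _ =>
      (hlim i).eventually (ge_mem_nhds (ENNReal.pow_pos (by simp) j))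
  obtain ⟨φ, hφ, hφsmall⟩ := Filter.extraction_forall_of_eventually' fun j =>
    Filter.eventually_atTop.1 (hsmall j)
  refine ⟨φ, hφ, fun i => ?_⟩
  rw [← ENNReal.summable.sum_add_tsum_nat_add' (k := i)]
  have htail : ∑' j, ν i (B (φ (j + i))) ≤ ∑' j, 2⁻¹ ^ j :=
    ENNReal.tsum_le_tsum fun j =>
      (hφsmall (j + i) i (by simp)).trans (pow_le_pow_right_of_le_one' (by simp) (by omega))
  refine ENNReal.add_ne_top.2
    ⟨ENNReal.sum_ne_top.2 fun _ _ => measure_ne_top _ _, (htail.trans_lt ?_).ne⟩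
  simp [ENNReal.tsum_geometric]

variable {d : ℕ} {Ω : Type*} [TopologicalSpace Ω] [MeasurableSpace Ω] {μ : Measure Ω}
  {F G : Ω → Set (Euc d)} {T : (Ω → Set (Euc d)) → Ω → Set (Euc d)}

/-- The number of members of a sequence of sets that contain a given point, with the junk value
`0` when there are infinitely many of them. -/
noncomputable def memCount {α : Type*} (B : ℕ → Set α) (x : α) : ℕ :=
  ⌊(∑' j, (B j).indicator (1 : α → ℝ≥0∞) x).toReal⌋₊

lemma memCount_le_tsum {α : Type*} (B : ℕ → Set α) (x : α) :
    (memCount B x : ℝ≥0∞) ≤ ∑' j, (B j).indicator (1 : α → ℝ≥0∞) x := by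
  rw [← ENNReal.ofReal_natCast]
  exact (ENNReal.ofReal_le_ofReal (Nat.floor_le ENNReal.toReal_nonneg)).trans
    ENNReal.ofReal_toReal_le

lemma le_memCount {α : Type*} {B : ℕ → Set α} (hB : Antitone B) {x : α} (hx : ∃ k, x ∉ B k)
    {m : ℕ} (hm : x ∈ B m) : m ≤ memCount B x := by
  obtain ⟨k, hk⟩ := hx
  have hsum : ∑' j, (B j).indicator (1 : α → ℝ≥0∞) x =
      ∑ j ∈ Finset.range k, (B j).indicator (1 : α → ℝ≥0∞) x :=
    tsum_eq_sum fun j hj => Set.indicator_of_notMem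
      (fun h => hk (hB (not_lt.1 (Finset.mem_range.not.1 hj)) h)) _
  have hfin : ∑' j, (B j).indicator (1 : α → ℝ≥0∞) x ≠ ∞ := by
    rw [hsum]
    exact ENNReal.sum_ne_top.2 fun j _ =>
      ((Set.indicator_le_self' (fun _ _ => zero_le) x).trans_lt ENNReal.one_lt_top).ne
  refine Nat.le_floor ((ENNReal.ofReal_le_iff_le_toReal hfin).1 ?_)
  calc ENNReal.ofReal m = ∑ j ∈ Finset.range m, (B j).indicator (1 : α → ℝ≥0∞) x := by
        rw [Finset.sum_congr rfl fun j hj =>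
          Set.indicator_of_mem (hB (Finset.mem_range.1 hj).le hm) _]
        simp
    _ ≤ ∑' j, (B j).indicator (1 : α → ℝ≥0∞) x := ENNReal.sum_le_tsum _

lemma measurable_memCount {α : Type*} [MeasurableSpace α] {B : ℕ → Set α}
    (hBm : ∀ k, MeasurableSet (B k)) : Measurable (memCount B) :=
  (Measurable.tsum fun k => measurable_one.indicator (hBm k)).ennreal_toReal.nat_floor

lemma exists_strictMono_memCount_smul_mem_locIntBdd [SecondCountableTopology Ω]
    (hF : F ∈ LocIntBdd μ d) {B : ℕ → Set Ω} (hB : Antitone B) (hBm : ∀ k, MeasurableSet (B k))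
    (hB0 : ∀ᵐ x ∂μ, ∃ k, x ∉ B k) :
    ∃ φ : ℕ → ℕ, StrictMono φ ∧
      (fun x => (memCount (fun j => B (φ j)) x : ℝ) • F x) ∈ LocIntBdd μ d := by
  set k : Ω → ℝ≥0∞ := fun x => ENNReal.ofReal (radius (F x))
  have hkm : Measurable k := hF.1.measurable.measurable_radius.ennreal_ofReal
  obtain ⟨u, huo, hu, hui⟩ := (locallyIntegrable_radius hF).exists_nat_integrableOn
  set ν : ℕ → Measure Ω := fun i => (μ.restrict (u i)).withDensity k
  have hfin (i : ℕ) : IsFiniteMeasure (ν i) :=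
    isFiniteMeasure_withDensity (hui i).lintegral_lt_top.ne
  have hnull (i : ℕ) : ν i (⋂ k, B k) = 0 :=
    ((withDensity_absolutelyContinuous _ _).trans Measure.restrict_le_self.absolutelyContinuous)
      (by simpa [ae_iff, Set.ofPred_forall] using hB0)
  obtain ⟨φ, hφ, hsum⟩ := exists_strictMono_tsum_measure_ne_top hB hBm hnull
  have hG := hF.1.natCast_smul (measurable_memCount fun j => hBm (φ j))
  refine ⟨φ, hφ, hG.mem_locIntBdd fun x => ?_⟩
  obtain ⟨i, hi⟩ := Set.mem_iUnion.1 (hu.ge (Set.mem_univ x))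
  refine ⟨u i, (huo i).mem_nhds hi, hG.measurable.measurable_radius.aestronglyMeasurable,
    lt_of_le_of_lt ?_ (hsum i).lt_top⟩
  have hind (j : ℕ) : Measurable ((B (φ j)).indicator (1 : Ω → ℝ≥0∞)) :=
    measurable_one.indicator (hBm (φ j))
  calc ∫⁻ x in u i, ‖radius ((memCount (fun j => B (φ j)) x : ℝ) • F x)‖ₑ ∂μ
      ≤ ∫⁻ x in u i, k x * ∑' j, (B (φ j)).indicator (1 : Ω → ℝ≥0∞) x ∂μ := by
        refine lintegral_mono fun x => ?_
        rw [Real.enorm_of_nonneg (radius_nonneg _), mul_comm]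
        refine (ENNReal.ofReal_le_ofReal ((hF.1.isKbcs x).radius_smul_le _)).trans ?_
        rw [Nat.abs_cast, ENNReal.ofReal_mul (Nat.cast_nonneg _), ENNReal.ofReal_natCast]
        gcongr
        exact memCount_le_tsum _ x
    _ = ∫⁻ x, ∑' j, (B (φ j)).indicator (1 : Ω → ℝ≥0∞) x ∂ν i :=
        (lintegral_withDensity_eq_lintegral_mul _ hkm (.tsum hind)).symm
    _ = ∑' j, ν i (B (φ j)) := by
        rw [lintegral_tsum fun j => (hind j).aemeasurable]
        simp only [lintegral_indicator_one (hBm _)]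

/-- Linear monotone operators on the locally integrably bounded functions that annihilate the
functions vanishing almost everywhere, so that they act on classes modulo null sets. -/
structure IsMonotoneOperator (μ : Measure Ω) (T : (Ω → Set (Euc d)) → Ω → Set (Euc d)) :
    Prop where
  map_mem : ∀ F ∈ LocIntBdd μ d, T F ∈ LocIntBdd μ d
  linear : IsLinearMonotoneOn μ (LocIntBdd μ d) T
  map_null : ∀ F ∈ LocIntBdd μ d, (∀ᵐ x ∂μ, F x = 0) → ∀ᵐ x ∂μ, T F x = 0

namespace IsMonotoneOperator

lemma isKbcs (hT : IsMonotoneOperator μ T) (hF : F ∈ LocIntBdd μ d) (x : Ω) : IsKbcs (T F x) :=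
  (hT.map_mem F hF).1.isKbcs x

lemma ae_subset (hT : IsMonotoneOperator μ T) (hF : F ∈ LocIntBdd μ d) (hG : G ∈ LocIntBdd μ d)
    (h : ∀ᵐ x ∂μ, F x ⊆ G x) : ∀ᵐ x ∂μ, T F x ⊆ T G x := by
  obtain ⟨N, hN, hNm, hN0⟩ := exists_measurable_superset_of_null (ae_iff.1 h)
  have hH : N.indicator F ∈ LocIntBdd μ d := indicator_mem_locIntBdd hF hNm
  have hTH : ∀ᵐ x ∂μ, T (N.indicator F) x = 0 := hT.map_null _ hH <|
    (measure_eq_zero_iff_ae_notMem.1 hN0).mono fun x hx => Set.indicator_of_notMem hx F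
  have hFGH (x : Ω) : F x ⊆ G x + N.indicator F x := by
    by_cases hx : x ∈ N
    · rw [Set.indicator_of_mem hx]
      exact (hG.1.isKbcs x).subset_add_right
    · rw [Set.indicator_of_notMem hx, add_zero]
      exact not_not.1 fun hFG => hx (hN hFG)
  filter_upwards [hTH, hT.linear.mono F hF _ (add_mem_locIntBdd hG hH) hFGH,
    hT.linear.map_add G hG _ hH] with x hx hsub hadd
  rwa [hadd, hx, add_zero] at hsub

lemma ae_monotone (hT : IsMonotoneOperator μ T) (hF : IsKbcsFun F) {A : ℕ → Set Ω}
    (hA : Monotone A) (hAF : ∀ k, (A k).indicator F ∈ LocIntBdd μ d) :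
    ∀ᵐ x ∂μ, Monotone fun k => T ((A k).indicator F) x := by
  have hsucc : ∀ᵐ x ∂μ, ∀ k, T ((A k).indicator F) x ⊆ T ((A (k + 1)).indicator F) x :=
    ae_all_iff.2 fun k => hT.linear.mono _ (hAF k) _ (hAF (k + 1))
      (hF.indicator_mono (hA k.le_succ))
  exact hsucc.mono fun x hx => monotone_nat_of_le_succ hx

lemma ae_exists_subset_closedBall [SecondCountableTopology Ω] (hT : IsMonotoneOperator μ T)
    (hF : F ∈ LocIntBdd μ d) {B : ℕ → Set Ω} (hB : Antitone B) (hBm : ∀ k, MeasurableSet (B k))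
    (hB0 : ∀ᵐ x ∂μ, ∃ k, x ∉ B k) :
    ∀ᵐ x ∂μ, ∀ ε > 0, ∃ k, T ((B k).indicator F) x ⊆ Metric.closedBall 0 ε := by
  obtain ⟨φ, hφ, hG⟩ := exists_strictMono_memCount_smul_mem_locIntBdd hF hB hBm hB0
  set N := memCount fun j => B (φ j)
  have hBF (m : ℕ) : (B (φ m)).indicator F ∈ LocIntBdd μ d := indicator_mem_locIntBdd hF (hBm _)
  have hmul (m : ℕ) : ∀ᵐ x ∂μ, (m : ℝ) • (B (φ m)).indicator F x ⊆ (N x : ℝ) • F x := by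
    filter_upwards [hB0] with x ⟨k, hk⟩
    by_cases hx : x ∈ B (φ m)
    · rw [Set.indicator_of_mem hx]
      have hmN : m ≤ N x := le_memCount (hB.comp_monotone hφ.monotone)
        ⟨k, fun h => hk (hB (hφ.id_le k) h)⟩ hx
      exact (hF.1.isKbcs x).smul_subset_smul (Nat.cast_nonneg _) (Nat.cast_le.2 hmN)
    · simpa [Set.indicator_of_notMem hx] using (hG.1.isKbcs x).zero_mem
  have hTmul : ∀ᵐ x ∂μ, ∀ m : ℕ, (m : ℝ) • T ((B (φ m)).indicator F) x ⊆
      T (fun x => (N x : ℝ) • F x) x := ae_all_iff.2 fun m => by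
    filter_upwards [hT.ae_subset (smul_mem_locIntBdd (hBF m) m) hG (hmul m),
      hT.linear.map_smul m _ (hBF m)] with x hsub hsmul
    rwa [hsmul] at hsub
  filter_upwards [hTmul] with x hx ε hε
  obtain ⟨m, hm⟩ := exists_nat_gt (radius (T (fun x => (N x : ℝ) • F x) x) / ε)
  have hm0 : (0 : ℝ) < m := (div_nonneg (radius_nonneg _) hε.le).trans_lt hm
  refine ⟨φ m, fun v hv => mem_closedBall_zero_iff.2 (le_of_mul_le_mul_left ?_ hm0)⟩
  calc (m : ℝ) * ‖v‖ = ‖(m : ℝ) • v‖ := by rw [norm_smul, Real.norm_natCast]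
    _ ≤ radius (T (fun x => (N x : ℝ) • F x) x) :=
      (hT.isKbcs hG x).norm_le_radius (hx m ⟨v, hv, rfl⟩)
    _ ≤ m * ε := ((div_lt_iff₀ hε).1 hm).le

lemma ae_eq_closure_iUnion [SecondCountableTopology Ω] (hT : IsMonotoneOperator μ T)
    (hF : F ∈ LocIntBdd μ d) {A : ℕ → Set Ω} (hA : Monotone A) (hAm : ∀ k, MeasurableSet (A k))
    (hA1 : ∀ᵐ x ∂μ, ∃ k, x ∈ A k) :
    ∀ᵐ x ∂μ, T F x = closure (⋃ k, T ((A k).indicator F) x) := by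
  have hAF (k : ℕ) : (A k).indicator F ∈ LocIntBdd μ d := indicator_mem_locIntBdd hF (hAm k)
  have hAF' (k : ℕ) : (A k)ᶜ.indicator F ∈ LocIntBdd μ d :=
    indicator_mem_locIntBdd hF (hAm k).compl
  have hsmall : ∀ᵐ x ∂μ, ∀ ε > 0, ∃ k, T ((A k)ᶜ.indicator F) x ⊆ Metric.closedBall 0 ε :=
    hT.ae_exists_subset_closedBall hF (fun i j hij => Set.compl_subset_compl.2 (hA hij))
      (fun k => (hAm k).compl) (by simpa using hA1)
  have hsplit : ∀ᵐ x ∂μ, ∀ k, T F x = T ((A k).indicator F) x + T ((A k)ᶜ.indicator F) x := by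
    refine ae_all_iff.2 fun k => ?_
    have hadd := hT.linear.map_add _ (hAF k) _ (hAF' k)
    rwa [← Pi.add_def, Set.indicator_self_add_compl] at hadd
  filter_upwards [hsmall, hsplit] with x hsmall hsplit
  refine subset_antisymm (fun v hv => Metric.mem_closure_iff.2 fun ε hε => ?_)
    (closure_minimal (Set.iUnion_subset fun k => ?_) (hT.isKbcs hF x).isClosed)
  · obtain ⟨k, hk⟩ := hsmall (ε / 2) (half_pos hε)
    rw [hsplit k] at hv
    obtain ⟨a, ha, b, hb, rfl⟩ := hv
    have hb' : ‖b‖ ≤ ε / 2 := mem_closedBall_zero_iff.1 (hk hb)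
    exact ⟨a, Set.mem_iUnion.2 ⟨k, ha⟩, by simpa [dist_eq_norm] using by linarith⟩
  · rw [hsplit k]
    exact (hT.isKbcs (hAF' k) x).subset_add_left

end IsMonotoneOperator

end MonotoneOperator

section Exhaustion

lemma closure_iUnion_add {E ι : Type*} [TopologicalSpace E] [T2Space E] [Add E] [ContinuousAdd E]
    [SemilatticeSup ι] {S S' : ι → Set E} (hS : Monotone S) (hS' : Monotone S')
    (h : IsCompact (closure (⋃ k, S k))) (h' : IsCompact (closure (⋃ k, S' k))) :
    closure (⋃ k, (S k + S' k)) = closure (⋃ k, S k) + closure (⋃ k, S' k) := by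
  have hprod : IsCompact (closure ((⋃ k, S k) ×ˢ ⋃ k, S' k)) := by
    rw [closure_prod_eq]
    exact h.prod h'
  rw [← Set.add_image_prod, ← closure_prod_eq,
    image_closure_of_isCompact hprod continuous_add.continuousOn,
    ← Set.iUnion_prod_of_monotone hS hS', Set.image_iUnion]
  simp only [Set.add_image_prod]

variable {d : ℕ} {Ω : Type*} [TopologicalSpace Ω] [MeasurableSpace Ω] {μ : Measure Ω}
  {F G : Ω → Set (Euc d)} {A B : ℕ → Set Ω} {T : (Ω → Set (Euc d)) → Ω → Set (Euc d)}

/-- Increasing sequences of measurable sets that cover `Ω` and to which the restrictions of `F`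
are locally integrably bounded. -/
structure IsExhaustion (μ : Measure Ω) (F : Ω → Set (Euc d)) (A : ℕ → Set Ω) : Prop where
  monotone : Monotone A
  measurableSet : ∀ k, MeasurableSet (A k)
  exists_mem : ∀ x, ∃ k, x ∈ A k
  mem_locIntBdd : ∀ k, (A k).indicator F ∈ LocIntBdd μ d

namespace IsExhaustion

lemma inter (hA : IsExhaustion μ F A) (hB : IsExhaustion μ G B) :
    IsExhaustion μ F fun k => B k ∩ A k where
  monotone := hB.monotone.inter hA.monotone
  measurableSet k := (hB.measurableSet k).inter (hA.measurableSet k)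
  exists_mem x := by
    obtain ⟨i, hi⟩ := hA.exists_mem x
    obtain ⟨j, hj⟩ := hB.exists_mem x
    exact ⟨max i j, hB.monotone (le_max_right i j) hj, hA.monotone (le_max_left i j) hi⟩
  mem_locIntBdd k := by
    rw [← Set.indicator_indicator]
    exact indicator_mem_locIntBdd (hA.mem_locIntBdd k) (hB.measurableSet k)

lemma of_subset (hA : IsExhaustion μ G A) (hF : IsKbcsFun F) (hFG : ∀ x, F x ⊆ G x) :
    IsExhaustion μ F A where
  monotone := hA.monotone
  measurableSet := hA.measurableSet
  exists_mem := hA.exists_mem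
  mem_locIntBdd k := (hF.indicator (hA.measurableSet k)).mem_locIntBdd_of_subset
    (hA.mem_locIntBdd k) fun x => by by_cases hx : x ∈ A k <;> simp [hx, hFG x]

lemma smul (hA : IsExhaustion μ F A) (c : ℝ) : IsExhaustion μ (fun x => c • F x) A where
  monotone := hA.monotone
  measurableSet := hA.measurableSet
  exists_mem := hA.exists_mem
  mem_locIntBdd k := by
    have hind : ((A k).indicator fun x => c • F x) = fun x => c • (A k).indicator F x :=
      Set.indicator_smul _ (fun _ => c) F
    rw [hind]
    exact smul_mem_locIntBdd (hA.mem_locIntBdd k) c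

lemma add (hF : IsExhaustion μ F A) (hG : IsExhaustion μ G A) :
    IsExhaustion μ (fun x => F x + G x) A where
  monotone := hF.monotone
  measurableSet := hF.measurableSet
  exists_mem := hF.exists_mem
  mem_locIntBdd k := by
    rw [Set.indicator_add]
    exact add_mem_locIntBdd (hF.mem_locIntBdd k) (hG.mem_locIntBdd k)

end IsExhaustion

lemma IsKbcsFun.isExhaustion_radius_le (hF : IsKbcsFun F) {g : Ω → ℝ} (hgm : Measurable g)
    (hg0 : ∀ x, 0 ≤ g x) (hg : LocallyIntegrable g μ) (hFg : ∀ x, g x = 0 → F x ⊆ 0) :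
    IsExhaustion μ F fun k => {x | radius (F x) ≤ k * g x} where
  monotone _ _ hij x hx := le_trans hx (mul_le_mul_of_nonneg_right (Nat.cast_le.2 hij) (hg0 x))
  measurableSet k := measurableSet_le hF.measurable.measurable_radius (hgm.const_mul _)
  exists_mem x := by
    rcases (hg0 x).eq_or_lt with hx | hx
    · refine ⟨0, radius_le (by simp [← hx]) fun v hv => ?_⟩
      simp [Set.mem_zero.1 (hFg x hx.symm hv)]
    · obtain ⟨k, hk⟩ := exists_nat_ge (radius (F x) / g x)
      exact ⟨k, (div_le_iff₀ hx).1 hk⟩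
  mem_locIntBdd k := hF.indicator_radius_le_mem_locIntBdd (hgm.const_mul _)
    (fun x => mul_nonneg k.cast_nonneg (hg0 x)) (hg.smul (k : ℝ))

/-- The limit of `T` along the restrictions of `F` to the sets `A k`. -/
def limAlong (T : (Ω → Set (Euc d)) → Ω → Set (Euc d)) (F : Ω → Set (Euc d)) (A : ℕ → Set Ω) :
    Ω → Set (Euc d) :=
  fun x => closure (⋃ k, T ((A k).indicator F) x)

namespace IsMonotoneOperator

lemma setMeasurable_limAlong (hT : IsMonotoneOperator μ T) (hA : IsExhaustion μ F A) :
    SetMeasurable (limAlong T F A) :=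
  .closure_iUnion fun k => (hT.map_mem _ (hA.mem_locIntBdd k)).1.measurable

lemma ae_limAlong_mono (hT : IsMonotoneOperator μ T) (hF : IsExhaustion μ F A)
    (hG : IsExhaustion μ G A) (hFG : ∀ x, F x ⊆ G x) :
    ∀ᵐ x ∂μ, limAlong T F A x ⊆ limAlong T G A x := by
  have hsub : ∀ᵐ x ∂μ, ∀ k, T ((A k).indicator F) x ⊆ T ((A k).indicator G) x :=
    ae_all_iff.2 fun k => hT.linear.mono _ (hF.mem_locIntBdd k) _ (hG.mem_locIntBdd k) fun x => by
      by_cases hx : x ∈ A k <;> simp [hx, hFG x]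
  exact hsub.mono fun x hx => closure_mono (Set.iUnion_mono hx)

lemma ae_limAlong_smul (hT : IsMonotoneOperator μ T) (hA : IsExhaustion μ F A) (c : ℝ) :
    ∀ᵐ x ∂μ, limAlong T (fun y => c • F y) A x = c • limAlong T F A x := by
  have hsmul : ∀ᵐ x ∂μ, ∀ k, T ((A k).indicator fun y => c • F y) x =
      c • T ((A k).indicator F) x := ae_all_iff.2 fun k => by
    have hind : ((A k).indicator fun y => c • F y) = fun y => c • (A k).indicator F y :=
      Set.indicator_smul _ (fun _ => c) F
    rw [hind]
    exact hT.linear.map_smul c _ (hA.mem_locIntBdd k)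
  filter_upwards [hsmul] with x hx
  rw [limAlong, Set.iUnion_congr hx, ← Set.smul_set_iUnion, closure_smul₀, limAlong]

lemma ae_limAlong_add (hT : IsMonotoneOperator μ T) (hF : IsKbcsFun F) (hG : IsKbcsFun G)
    (hFA : IsExhaustion μ F A) (hGA : IsExhaustion μ G A)
    (hFc : ∀ᵐ x ∂μ, IsCompact (limAlong T F A x)) (hGc : ∀ᵐ x ∂μ, IsCompact (limAlong T G A x)) :
    ∀ᵐ x ∂μ, limAlong T (fun y => F y + G y) A x = limAlong T F A x + limAlong T G A x := by
  have hadd : ∀ᵐ x ∂μ, ∀ k, T ((A k).indicator fun y => F y + G y) x =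
      T ((A k).indicator F) x + T ((A k).indicator G) x := ae_all_iff.2 fun k => by
    rw [Set.indicator_add]
    exact hT.linear.map_add _ (hFA.mem_locIntBdd k) _ (hGA.mem_locIntBdd k)
  filter_upwards [hadd, hT.ae_monotone hF hFA.monotone hFA.mem_locIntBdd,
    hT.ae_monotone hG hGA.monotone hGA.mem_locIntBdd, hFc, hGc] with x hx hFm hGm hFc hGc
  rw [limAlong, Set.iUnion_congr hx]
  exact closure_iUnion_add hFm hGm hFc hGc

variable [SecondCountableTopology Ω]

lemma ae_limAlong_eq (hT : IsMonotoneOperator μ T) (hF : F ∈ LocIntBdd μ d)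
    (hA : IsExhaustion μ F A) : ∀ᵐ x ∂μ, limAlong T F A x = T F x :=
  (hT.ae_eq_closure_iUnion hF hA.monotone hA.measurableSet (.of_forall hA.exists_mem)).mono
    fun _ => Eq.symm

lemma ae_limAlong_subset_limAlong (hT : IsMonotoneOperator μ T) (hF : IsKbcsFun F)
    (hA : IsExhaustion μ F A) (hB : IsExhaustion μ F B) :
    ∀ᵐ x ∂μ, limAlong T F B x ⊆ limAlong T F A x := by
  have heq : ∀ᵐ x ∂μ, ∀ k, T ((B k).indicator F) x =
      closure (⋃ m, T ((A m).indicator ((B k).indicator F)) x) :=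
    ae_all_iff.2 fun k => hT.ae_eq_closure_iUnion (hB.mem_locIntBdd k) hA.monotone
      hA.measurableSet (.of_forall hA.exists_mem)
  have hsub : ∀ᵐ x ∂μ, ∀ k m, T ((A m).indicator ((B k).indicator F)) x ⊆
      T ((A m).indicator F) x := by
    refine ae_all_iff.2 fun k => ae_all_iff.2 fun m => hT.linear.mono _
      (indicator_mem_locIntBdd (hB.mem_locIntBdd k) (hA.measurableSet m)) _
      (hA.mem_locIntBdd m) fun x => ?_
    rw [Set.indicator_indicator]
    exact hF.indicator_mono Set.inter_subset_left x
  filter_upwards [heq, hsub] with x heq hsub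
  refine closure_minimal (Set.iUnion_subset fun k => ?_) isClosed_closure
  rw [heq k]
  exact closure_mono (Set.iUnion_mono (hsub k))

lemma ae_limAlong_eq_limAlong (hT : IsMonotoneOperator μ T) (hF : IsKbcsFun F)
    (hA : IsExhaustion μ F A) (hB : IsExhaustion μ F B) :
    ∀ᵐ x ∂μ, limAlong T F A x = limAlong T F B x := by
  filter_upwards [hT.ae_limAlong_subset_limAlong hF hA hB,
    hT.ae_limAlong_subset_limAlong hF hB hA] with x hBA hAB
  exact hAB.antisymm hBA

end IsMonotoneOperator

end Exhaustion

section StrongType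

variable {d : ℕ} {Ω : Type*} [MeasurableSpace Ω] {μ : Measure Ω} {ρ σ : Ω → Euc d → ℝ}
  {F G : Ω → Set (Euc d)} {p q : ℝ}

lemma lintegral_rpow_le_of_le_geomMean {H G₀ G₁ : Ω → ℝ≥0∞} {c : ℝ≥0∞} {θ q₀ q₁ : ℝ}
    (hθ₀ : 0 ≤ θ) (hθ₁ : θ ≤ 1) (hq : 0 < q) (hq₀ : 0 < q₀) (hq₁ : 0 < q₁)
    (hqθ : 1 / q = (1 - θ) / q₀ + θ / q₁) (hG₀ : Measurable G₀) (hG₁ : Measurable G₁)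
    (h : ∀ᵐ x ∂μ, H x ≤ c * (G₀ x ^ (1 - θ) * G₁ x ^ θ)) :
    (∫⁻ x, H x ^ q ∂μ) ^ (1 / q) ≤ c * (((∫⁻ x, G₀ x ^ q₀ ∂μ) ^ (1 / q₀)) ^ (1 - θ) *
      ((∫⁻ x, G₁ x ^ q₁ ∂μ) ^ (1 / q₁)) ^ θ) := by
  have : 0 ≤ 1 - θ := sub_nonneg.2 hθ₁
  set a := (1 - θ) / q₀ * q with ha
  set b := θ / q₁ * q with hb
  have hab : a + b = 1 := by rw [ha, hb, ← add_mul, ← hqθ, one_div_mul_cancel hq.ne']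
  have hpow : ∀ᵐ x ∂μ, H x ^ q ≤ c ^ q * ((G₀ x ^ q₀) ^ a * (G₁ x ^ q₁) ^ b) := by
    filter_upwards [h] with x hx
    refine (ENNReal.rpow_le_rpow hx hq.le).trans_eq ?_
    simp only [ENNReal.mul_rpow_of_nonneg _ _ hq.le, ← ENNReal.rpow_mul]
    rw [ha, hb, ← mul_assoc q₀, ← mul_assoc q₁, mul_div_cancel₀ _ hq₀.ne',
      mul_div_cancel₀ _ hq₁.ne']
  have hint : ∫⁻ x, H x ^ q ∂μ ≤
      c ^ q * ((∫⁻ x, G₀ x ^ q₀ ∂μ) ^ a * (∫⁻ x, G₁ x ^ q₁ ∂μ) ^ b) := by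
    refine (lintegral_mono_ae hpow).trans ?_
    rw [lintegral_const_mul _ (by fun_prop)]
    gcongr
    exact ENNReal.lintegral_mul_norm_pow_le (by fun_prop) (by fun_prop) (by positivity)
      (by positivity) hab
  refine (ENNReal.rpow_le_rpow hint (one_div_pos.2 hq).le).trans_eq ?_
  simp only [ENNReal.mul_rpow_of_nonneg _ _ (one_div_pos.2 hq).le, ← ENNReal.rpow_mul]
  rw [ha, hb, mul_assoc _ q, mul_assoc _ q, mul_one_div_cancel hq.ne', ENNReal.rpow_one, mul_one,
    mul_one, one_div_mul_eq_div, one_div_mul_eq_div]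

lemma normLpK_mono (hp : 0 < p) (h : ∀ᵐ x ∂μ, F x ⊆ G x) : normLpK μ p ρ F ≤ normLpK μ p ρ G :=
  ENNReal.rpow_le_rpow (lintegral_mono_ae <| h.mono fun _ hx =>
    ENNReal.rpow_le_rpow (supOn_mono hx) hp.le) (one_div_pos.2 hp).le

lemma lintegral_supOn_rpow_lt_top (hp : 0 < p) (h : normLpK μ p ρ F < ∞) :
    ∫⁻ x, supOn (ρ x) (F x) ^ p ∂μ < ∞ :=
  (ENNReal.rpow_lt_top_iff_of_pos (one_div_pos.2 hp)).1 h

lemma normLpK_eq_zero_iff (hρ : IsNormFunction ρ) (hp : 0 < p) (hF : IsKbcsFun F) :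
    normLpK μ p ρ F = 0 ↔ ∀ᵐ x ∂μ, F x = 0 := by
  rw [normLpK, ENNReal.rpow_eq_zero_iff_of_pos (one_div_pos.2 hp),
    lintegral_eq_zero_iff ((hρ.measurable_supOn hF.measurable).pow_const p)]
  refine Filter.eventually_congr (.of_forall fun x => ?_)
  rw [Pi.zero_apply, ENNReal.rpow_eq_zero_iff_of_pos hp]
  refine ⟨fun h => ((hρ.isGauge x).subset_zero_of_supOn_eq_zero h).antisymm
    (Set.zero_subset.2 (hF.isKbcs x).zero_mem), fun h => ?_⟩
  rw [h, ← nonpos_iff_eq_zero, supOn_le_iff]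
  rintro v rfl
  rw [(hρ.isGauge x).map_zero, ENNReal.ofReal_zero]

lemma integrable_toReal_supOn_rpow (hρ : IsNormFunction ρ) (hp : 0 < p) (hF : F ∈ LpK μ p ρ) :
    Integrable (fun x => (supOn (ρ x) (F x)).toReal ^ p) μ := by
  simp only [ENNReal.toReal_rpow]
  exact integrable_toReal_of_lintegral_ne_top
    ((hρ.measurable_supOn hF.1.measurable).pow_const p).aemeasurable
    (lintegral_supOn_rpow_lt_top hp hF.2).ne

lemma ae_supOn_lt_top (hρ : IsNormFunction ρ) (hp : 0 < p) (hF : SetMeasurable F)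
    (h : normLpK μ p ρ F < ∞) : ∀ᵐ x ∂μ, supOn (ρ x) (F x) < ∞ :=
  (ae_lt_top ((hρ.measurable_supOn hF).pow_const p)
    (lintegral_supOn_rpow_lt_top hp h).ne).mono fun _ => (ENNReal.rpow_lt_top_iff_of_pos hp).1

lemma normLpK_closure_iUnion (hρ : IsNormFunction ρ) (hp : 0 < p) {H : ℕ → Ω → Set (Euc d)}
    (hH : ∀ k, SetMeasurable (H k)) (hmono : ∀ᵐ x ∂μ, Monotone fun k => H k x) :
    normLpK μ p ρ (fun x => closure (⋃ k, H k x)) = ⨆ k, normLpK μ p ρ (H k) := by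
  have hsup (x : Ω) : supOn (ρ x) (closure (⋃ k, H k x)) ^ p = ⨆ k, supOn (ρ x) (H k x) ^ p := by
    rw [supOn_closure_iUnion (hρ.isNorm x).continuous]
    exact (ENNReal.orderIsoRpow p hp).map_iSup _
  simp only [normLpK, hsup]
  rw [lintegral_iSup' fun k => ((hρ.measurable_supOn (hH k)).pow_const p).aemeasurable]
  · exact (ENNReal.orderIsoRpow (1 / p) (one_div_pos.2 hp)).map_iSup _
  · filter_upwards [hmono] with x hx i j hij
    exact ENNReal.rpow_le_rpow (supOn_mono (hx hij)) hp.le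

variable [TopologicalSpace Ω] {T : (Ω → Set (Euc d)) → Ω → Set (Euc d)} {M : ℝ≥0} {A : ℕ → Set Ω}

/-- `T` is bounded from `L^p_𝒦(Ω, ρ)` to `L^q_𝒦(Ω, ρ)` with constant `M`, on the locally integrably
bounded functions. -/
def HasStrongType (μ : Measure Ω) (ρ : Ω → Euc d → ℝ) (p q : ℝ) (M : ℝ≥0)
    (T : (Ω → Set (Euc d)) → Ω → Set (Euc d)) : Prop :=
  ∀ F ∈ LocIntBdd μ d, F ∈ LpK μ p ρ → normLpK μ q ρ (T F) ≤ M * normLpK μ p ρ F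

lemma HasStrongType.isMonotoneOperator (hM : HasStrongType μ ρ p q M T) (hρ : IsNormFunction ρ)
    (hp : 0 < p) (hq : 0 < q) (hTX : ∀ F ∈ LocIntBdd μ d, T F ∈ LocIntBdd μ d)
    (hT : IsLinearMonotoneOn μ (LocIntBdd μ d) T) : IsMonotoneOperator μ T where
  map_mem := hTX
  linear := hT
  map_null F hF hF0 := by
    have hnorm : normLpK μ p ρ F = 0 := (normLpK_eq_zero_iff hρ hp hF.1).2 hF0
    refine (normLpK_eq_zero_iff hρ hq (hTX F hF).1).1 (nonpos_iff_eq_zero.1 ?_)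
    simpa [hnorm] using hM F hF ⟨hF.1, hnorm.trans_lt ENNReal.zero_lt_top⟩

lemma IsMonotoneOperator.normLpK_limAlong (hT : IsMonotoneOperator μ T) (hρ : IsNormFunction ρ)
    (hq : 0 < q) (hF : IsKbcsFun F) (hA : IsExhaustion μ F A) :
    normLpK μ q ρ (limAlong T F A) = ⨆ k, normLpK μ q ρ (T ((A k).indicator F)) :=
  normLpK_closure_iUnion hρ hq (fun k => (hT.map_mem _ (hA.mem_locIntBdd k)).1.measurable)
    (hT.ae_monotone hF hA.monotone hA.mem_locIntBdd)

lemma HasStrongType.normLpK_limAlong_le (hM : HasStrongType μ ρ p q M T)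
    (hT : IsMonotoneOperator μ T) (hρ : IsNormFunction ρ) (hp : 0 < p) (hq : 0 < q)
    (hF : F ∈ LpK μ p ρ) (hA : IsExhaustion μ F A) :
    normLpK μ q ρ (limAlong T F A) ≤ M * normLpK μ p ρ F := by
  rw [hT.normLpK_limAlong hρ hq hF.1 hA]
  refine iSup_le fun k => ?_
  have hle : normLpK μ p ρ ((A k).indicator F) ≤ normLpK μ p ρ F :=
    normLpK_mono hp (.of_forall (hF.1.indicator_subset _))
  refine (hM _ (hA.mem_locIntBdd k)
    ⟨hF.1.indicator (hA.measurableSet k), hle.trans_lt hF.2⟩).trans ?_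
  gcongr

end StrongType

section Extremal

variable {d : ℕ} {Ω : Type*} [MeasurableSpace Ω] {μ : Measure Ω} {ρ σ ρ₀ ρ₁ : Ω → Euc d → ℝ}
  {F : Ω → Set (Euc d)} {θ p p₀ r r₀ r₁ : ℝ}

/-- The `σ`-balls of radius `ρ_x(F(x))^r`. With `r = p / pᵢ` and `σ = ρᵢ` these are the extremal
majorants at the two endpoints of a function `F` in `L^p_𝒦(Ω, ρ)`. -/
noncomputable def extremal (ρ σ : Ω → Euc d → ℝ) (r : ℝ) (F : Ω → Set (Euc d)) :
    Ω → Set (Euc d) :=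
  normBall σ fun x => (supOn (ρ x) (F x)).toReal ^ r

lemma isKbcsFun_extremal (hρ : IsNormFunction ρ) (hσ : IsNormFunction σ) (r : ℝ)
    (hF : IsKbcsFun F) : IsKbcsFun (extremal ρ σ r F) :=
  hσ.isKbcsFun_normBall ((hρ.measurable_supOn hF.measurable).ennreal_toReal.pow_const r)
    fun _ => Real.rpow_nonneg ENNReal.toReal_nonneg r

lemma normLpK_extremal_le (hp : 0 < p) (hp₀ : 0 < p₀) :
    normLpK μ p₀ σ (extremal ρ σ (p / p₀) F) ≤ normLpK μ p ρ F ^ (p / p₀) := by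
  rw [normLpK, normLpK, ← ENNReal.rpow_mul, one_div_mul_eq_div, div_div_cancel_left' hp.ne',
    inv_eq_one_div]
  refine ENNReal.rpow_le_rpow (lintegral_mono fun x => ?_) (one_div_pos.2 hp₀).le
  calc supOn (σ x) (extremal ρ σ (p / p₀) F x) ^ p₀
      ≤ ENNReal.ofReal ((supOn (ρ x) (F x)).toReal ^ (p / p₀)) ^ p₀ :=
        ENNReal.rpow_le_rpow (supOn_normBall_le _ _ _) hp₀.le
    _ ≤ (supOn (ρ x) (F x) ^ (p / p₀)) ^ p₀ := by
        rw [ENNReal.toReal_rpow]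
        exact ENNReal.rpow_le_rpow ENNReal.ofReal_toReal_le hp₀.le
    _ = supOn (ρ x) (F x) ^ p := by rw [← ENNReal.rpow_mul, div_mul_cancel₀ _ hp₀.ne']

lemma extremal_subset_zero (hσ : IsNormFunction σ) (hp : 0 < p) (hr : 0 < r) {x : Ω}
    (hx : (supOn (ρ x) (F x)).toReal ^ p = 0) :
    extremal ρ σ r F x ⊆ 0 := fun v hv => by
  rw [Real.rpow_eq_zero ENNReal.toReal_nonneg hp.ne'] at hx
  have hv : σ x v ≤ (supOn (ρ x) (F x)).toReal ^ r := hv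
  rw [hx, Real.zero_rpow hr.ne'] at hv
  exact hσ.eq_zero x v (hv.antisymm (hσ.nonneg x v))

lemma subset_smul_extremal_add_smul_extremal (hρ₀ : IsNormFunction ρ₀) (hρ₁ : IsNormFunction ρ₁)
    (hθ₀ : 0 < θ) (hθ₁ : θ < 1) (hr : (1 - θ) * r₀ + θ * r₁ = 1) (hF : IsKbcsFun F)
    {t : ℝ} (ht : 0 < t) (x : Ω) :
    F x ⊆ t ^ θ • extremal (interpNorm θ ρ₀ ρ₁) ρ₀ r₀ F x +
      t ^ (θ - 1) • extremal (interpNorm θ ρ₀ ρ₁) ρ₁ r₁ F x := by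
  intro v hv
  set N := (supOn (interpNorm θ ρ₀ ρ₁ x) (F x)).toReal
  have hN0 : 0 ≤ N := ENNReal.toReal_nonneg
  rw [extremal, extremal, normBall, normBall,
    (hρ₀.isGauge x).smul_setOf_le (Real.rpow_pos_of_pos ht _),
    (hρ₁.isGauge x).smul_setOf_le (Real.rpow_pos_of_pos ht _)]
  refine mem_add_of_dual_dual_geomMean_le (hρ₀.isNorm x) (hρ₁.isNorm x) hθ₀ hθ₁
    (by positivity) (by positivity) ?_
  have hprod : (t ^ θ * N ^ r₀) ^ (1 - θ) * (t ^ (θ - 1) * N ^ r₁) ^ θ = N := by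
    have ht1 : (t ^ θ) ^ (1 - θ) * (t ^ (θ - 1)) ^ θ = 1 := by
      rw [← Real.rpow_mul ht.le, ← Real.rpow_mul ht.le, ← Real.rpow_add ht]
      ring_nf
      exact Real.rpow_zero t
    have hN1 : (N ^ r₀) ^ (1 - θ) * (N ^ r₁) ^ θ = N := by
      rw [← Real.rpow_mul hN0, ← Real.rpow_mul hN0, ← Real.rpow_add' hN0 (by linarith),
        mul_comm r₀, mul_comm r₁, hr, Real.rpow_one]
    rw [Real.mul_rpow (by positivity) (by positivity), Real.mul_rpow (by positivity)
      (by positivity), mul_mul_mul_comm, ht1, hN1, one_mul]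
  rw [hprod]
  exact le_toReal_supOn (((hρ₀.interpNorm hρ₁ hθ₀ hθ₁).isGauge x).supOn_lt_top
    (hF.isKbcs x).isBounded).ne hv

lemma indicator_subset_smul_indicator_extremal (hρ₀ : IsNormFunction ρ₀)
    (hρ₁ : IsNormFunction ρ₁) (hθ₀ : 0 < θ) (hθ₁ : θ < 1) (hr : (1 - θ) * r₀ + θ * r₁ = 1)
    (hF : IsKbcsFun F) {t : ℝ} (ht : 0 < t) (A : Set Ω) (x : Ω) :
    A.indicator F x ⊆ t ^ θ • A.indicator (extremal (interpNorm θ ρ₀ ρ₁) ρ₀ r₀ F) x +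
      t ^ (θ - 1) • A.indicator (extremal (interpNorm θ ρ₀ ρ₁) ρ₁ r₁ F) x := by
  by_cases hx : x ∈ A
  · simpa only [Set.indicator_of_mem hx]
      using subset_smul_extremal_add_smul_extremal hρ₀ hρ₁ hθ₀ hθ₁ hr hF ht x
  · simp only [Set.indicator_of_notMem hx, smul_zero, add_zero, subset_rfl]

end Extremal

section Interpolation

variable {d : ℕ} {Ω : Type*} [TopologicalSpace Ω] [MeasurableSpace Ω] {μ : Measure Ω}
  {ρ ρ₀ ρ₁ σ : Ω → Euc d → ℝ} {F F₀ F₁ : Ω → Set (Euc d)} {T : (Ω → Set (Euc d)) → Ω → Set (Euc d)}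
  {θ p₀ p₁ q₀ q₁ p q : ℝ} {M₀ M₁ : ℝ≥0}

lemma pos_of_one_div_eq (hθ₀ : 0 < θ) (hθ₁ : θ < 1) (hp₀ : 0 < p₀) (hp₁ : 0 < p₁)
    (hp : 1 / p = (1 - θ) / p₀ + θ / p₁) : 0 < p := by
  have : 0 < 1 - θ := sub_pos.2 hθ₁
  exact one_div_pos.1 (hp ▸ by positivity)

lemma supOn_dual_dual_geomMean_le {g₀ g₁ : Euc d → ℝ} (h₀ : IsNorm g₀) (h₁ : IsNorm g₁)
    (hθ₀ : 0 < θ) (hθ₁ : θ < 1) {S S₀ S₁ : Set (Euc d)} (hS₀ : Bornology.IsBounded S₀)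
    (hS₁ : Bornology.IsBounded S₁)
    (h : ∀ t : ℚ, 0 < t → S ⊆ (t : ℝ) ^ θ • S₀ + (t : ℝ) ^ (θ - 1) • S₁) :
    supOn (dual (dual (geomMean θ g₀ g₁))) S ≤
      (3 * 2 ^ d : ℝ≥0) * (supOn g₀ S₀ ^ (1 - θ) * supOn g₁ S₁ ^ θ) := by
  have hfin₀ := (h₀.isGauge.supOn_lt_top hS₀).ne
  have hfin₁ := (h₁.isGauge.supOn_lt_top hS₁).ne
  refine supOn_le_iff.2 fun v hv => ?_
  have hv : dual (dual (geomMean θ g₀ g₁)) v ≤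
      3 * 2 ^ d * ((supOn g₀ S₀).toReal ^ (1 - θ) * (supOn g₁ S₁).toReal ^ θ) := by
    refine dual_dual_geomMean_le_of_forall_mem_splitBall h₀ h₁ hθ₀ hθ₁ ENNReal.toReal_nonneg
      ENNReal.toReal_nonneg fun t ht => ?_
    have ht' : (0 : ℝ) < t := Rat.cast_pos.2 ht
    rw [splitBall, ← h₀.isGauge.smul_setOf_le (Real.rpow_pos_of_pos ht' _),
      ← h₁.isGauge.smul_setOf_le (Real.rpow_pos_of_pos ht' _)]
    exact Set.add_subset_add (Set.smul_set_mono fun a => le_toReal_supOn hfin₀)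
      (Set.smul_set_mono fun b => le_toReal_supOn hfin₁) (h t ht hv)
  refine (ENNReal.ofReal_le_ofReal hv).trans_eq ?_
  rw [ENNReal.toReal_rpow, ENNReal.toReal_rpow, ← ENNReal.toReal_mul,
    ENNReal.ofReal_mul (by positivity), ENNReal.ofReal_toReal (ENNReal.mul_ne_top
      (ENNReal.rpow_ne_top_of_nonneg (sub_pos.2 hθ₁).le hfin₀)
      (ENNReal.rpow_ne_top_of_nonneg hθ₀.le hfin₁)),
    ← ENNReal.ofReal_coe_nnreal]
  norm_num

lemma IsMonotoneOperator.ae_subset_smul_add_smul (hT : IsMonotoneOperator μ T)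
    (hF : F ∈ LocIntBdd μ d) (hF₀ : F₀ ∈ LocIntBdd μ d) (hF₁ : F₁ ∈ LocIntBdd μ d) {a b : ℝ}
    (h : ∀ x, F x ⊆ a • F₀ x + b • F₁ x) : ∀ᵐ x ∂μ, T F x ⊆ a • T F₀ x + b • T F₁ x := by
  have haF₀ := smul_mem_locIntBdd hF₀ a
  have hbF₁ := smul_mem_locIntBdd hF₁ b
  filter_upwards [hT.linear.mono F hF _ (add_mem_locIntBdd haF₀ hbF₁) h,
    hT.linear.map_add _ haF₀ _ hbF₁, hT.linear.map_smul a F₀ hF₀, hT.linear.map_smul b F₁ hF₁]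
    with x hsub hadd hsmul₀ hsmul₁
  rwa [hadd, hsmul₀, hsmul₁] at hsub

lemma IsMonotoneOperator.normLpK_interpNorm_le (hT : IsMonotoneOperator μ T)
    (hρ₀ : IsNormFunction ρ₀) (hρ₁ : IsNormFunction ρ₁) (hθ₀ : 0 < θ) (hθ₁ : θ < 1)
    (hq₀ : 0 < q₀) (hq₁ : 0 < q₁) (hq : 1 / q = (1 - θ) / q₀ + θ / q₁) (hF : F ∈ LocIntBdd μ d)
    (hF₀ : F₀ ∈ LocIntBdd μ d) (hF₁ : F₁ ∈ LocIntBdd μ d)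
    (h : ∀ t : ℝ, 0 < t → ∀ x, F x ⊆ t ^ θ • F₀ x + t ^ (θ - 1) • F₁ x) :
    normLpK μ q (interpNorm θ ρ₀ ρ₁) (T F) ≤
      (3 * 2 ^ d : ℝ≥0) * (normLpK μ q₀ ρ₀ (T F₀) ^ (1 - θ) * normLpK μ q₁ ρ₁ (T F₁) ^ θ) := by
  have hsub : ∀ᵐ x ∂μ, ∀ t : ℚ, 0 < t →
      T F x ⊆ (t : ℝ) ^ θ • T F₀ x + (t : ℝ) ^ (θ - 1) • T F₁ x :=
    ae_all_iff.2 fun t => Filter.eventually_imp_distrib_left.2 fun ht =>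
      hT.ae_subset_smul_add_smul hF hF₀ hF₁ (h t (Rat.cast_pos.2 ht))
  refine lintegral_rpow_le_of_le_geomMean hθ₀.le hθ₁.le (pos_of_one_div_eq hθ₀ hθ₁ hq₀ hq₁ hq)
    hq₀ hq₁ hq (hρ₀.measurable_supOn (hT.map_mem _ hF₀).1.measurable)
    (hρ₁.measurable_supOn (hT.map_mem _ hF₁).1.measurable) ?_
  exact hsub.mono fun x hx => supOn_dual_dual_geomMean_le (hρ₀.isNorm x) (hρ₁.isNorm x) hθ₀ hθ₁
    (hT.isKbcs hF₀ x).isBounded (hT.isKbcs hF₁ x).isBounded hx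

lemma isExhaustion_extremal (hρ₀ : IsNormFunction ρ₀) (hρ₁ : IsNormFunction ρ₁)
    (hρ : IsNormFunction ρ) (hp : 0 < p) {r₀ r₁ : ℝ} (hr₀ : 0 < r₀) (hr₁ : 0 < r₁)
    (hF : F ∈ LpK μ p ρ) :
    ∃ A, IsExhaustion μ (extremal ρ ρ₀ r₀ F) A ∧ IsExhaustion μ (extremal ρ ρ₁ r₁ F) A := by
  have hF₀ := isKbcsFun_extremal hρ hρ₀ r₀ hF.1
  have hF₁ := isKbcsFun_extremal hρ hρ₁ r₁ hF.1
  have hA := (hF₀.add hF₁).isExhaustion_radius_le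
    ((hρ.measurable_supOn hF.1.measurable).ennreal_toReal.pow_const p)
    (fun _ => Real.rpow_nonneg ENNReal.toReal_nonneg p)
    (integrable_toReal_supOn_rpow hρ hp hF).locallyIntegrable fun x hx => by
      simpa only [add_zero] using Set.add_subset_add
        (extremal_subset_zero hρ₀ hp hr₀ hx) (extremal_subset_zero hρ₁ hp hr₁ hx)
  exact ⟨_, hA.of_subset hF₀ fun x => (hF₁.isKbcs x).subset_add_left,
    hA.of_subset hF₁ fun x => (hF₀.isKbcs x).subset_add_right⟩

lemma HasStrongType.normLpK_indicator_extremal_le (hM : HasStrongType μ σ p₀ q₀ M₀ T)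
    (hρ : IsNormFunction ρ) (hσ : IsNormFunction σ) (hp : 0 < p) (hp₀ : 0 < p₀)
    (hF : F ∈ LpK μ p ρ) {A : Set Ω}
    (hA : A.indicator (extremal ρ σ (p / p₀) F) ∈ LocIntBdd μ d) :
    normLpK μ q₀ σ (T (A.indicator (extremal ρ σ (p / p₀) F))) ≤
      M₀ * normLpK μ p ρ F ^ (p / p₀) := by
  have hle : normLpK μ p₀ σ (A.indicator (extremal ρ σ (p / p₀) F)) ≤
      normLpK μ p ρ F ^ (p / p₀) :=
    (normLpK_mono hp₀ (.of_forall ((isKbcsFun_extremal hρ hσ _ hF.1).indicator_subset A))).trans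
      (normLpK_extremal_le hp hp₀)
  have hfin := ENNReal.rpow_lt_top_of_nonneg (div_pos hp hp₀).le hF.2.ne
  refine (hM _ hA ⟨hA.1, hle.trans_lt hfin⟩).trans ?_
  gcongr

lemma normLpK_map_indicator_le (hM₀ : HasStrongType μ ρ₀ p₀ q₀ M₀ T)
    (hM₁ : HasStrongType μ ρ₁ p₁ q₁ M₁ T) (hT : IsMonotoneOperator μ T)
    (hρ₀ : IsNormFunction ρ₀) (hρ₁ : IsNormFunction ρ₁) (hθ₀ : 0 < θ) (hθ₁ : θ < 1)
    (hp₀ : 0 < p₀) (hp₁ : 0 < p₁) (hq₀ : 0 < q₀) (hq₁ : 0 < q₁)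
    (hp : 1 / p = (1 - θ) / p₀ + θ / p₁) (hq : 1 / q = (1 - θ) / q₀ + θ / q₁)
    (hF : F ∈ LpK μ p (interpNorm θ ρ₀ ρ₁)) {A : Set Ω} (hFA : A.indicator F ∈ LocIntBdd μ d)
    (hA₀ : A.indicator (extremal (interpNorm θ ρ₀ ρ₁) ρ₀ (p / p₀) F) ∈ LocIntBdd μ d)
    (hA₁ : A.indicator (extremal (interpNorm θ ρ₀ ρ₁) ρ₁ (p / p₁) F) ∈ LocIntBdd μ d) :
    normLpK μ q (interpNorm θ ρ₀ ρ₁) (T (A.indicator F)) ≤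
      (3 * 2 ^ d * (M₀ ^ (1 - θ) * M₁ ^ θ) : ℝ≥0) * normLpK μ p (interpNorm θ ρ₀ ρ₁) F := by
  have hp' := pos_of_one_div_eq hθ₀ hθ₁ hp₀ hp₁ hp
  have hθ' : 0 ≤ 1 - θ := sub_nonneg.2 hθ₁.le
  have hρ := hρ₀.interpNorm hρ₁ hθ₀ hθ₁
  have hr : (1 - θ) * (p / p₀) + θ * (p / p₁) = 1 := by
    rw [← mul_div_assoc, mul_comm _ p, mul_div_assoc, ← mul_div_assoc θ, mul_comm θ,
      mul_div_assoc, ← mul_add, ← hp, mul_one_div_cancel hp'.ne']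
  refine (hT.normLpK_interpNorm_le hρ₀ hρ₁ hθ₀ hθ₁ hq₀ hq₁ hq hFA hA₀ hA₁ fun t ht x =>
    indicator_subset_smul_indicator_extremal hρ₀ hρ₁ hθ₀ hθ₁ hr hF.1 ht A x).trans ?_
  set I := normLpK μ p (interpNorm θ ρ₀ ρ₁) F
  calc _ ≤ ((3 * 2 ^ d : ℝ≥0) : ℝ≥0∞) *
        ((M₀ * I ^ (p / p₀)) ^ (1 - θ) * (M₁ * I ^ (p / p₁)) ^ θ) := by
        gcongr
        · exact hM₀.normLpK_indicator_extremal_le hρ hρ₀ hp' hp₀ hF hA₀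
        · exact hM₁.normLpK_indicator_extremal_le hρ hρ₁ hp' hp₁ hF hA₁
    _ = (3 * 2 ^ d * (M₀ ^ (1 - θ) * M₁ ^ θ) : ℝ≥0) *
        I ^ ((1 - θ) * (p / p₀) + θ * (p / p₁)) := by
        rw [ENNReal.mul_rpow_of_nonneg _ _ hθ', ENNReal.mul_rpow_of_nonneg _ _ hθ₀.le,
          ← ENNReal.rpow_mul, ← ENNReal.rpow_mul, mul_comm (p / p₀), mul_comm (p / p₁),
          ENNReal.rpow_add_of_nonneg _ _ (by positivity) (by positivity), mul_mul_mul_comm,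
          ENNReal.coe_mul _ (_ * _), ENNReal.coe_mul (_ ^ _), ENNReal.coe_rpow_of_nonneg _ hθ',
          ENNReal.coe_rpow_of_nonneg _ hθ₀.le]
        ring
    _ = _ := by rw [hr, ENNReal.rpow_one]

theorem HasStrongType.interpNorm [SecondCountableTopology Ω]
    (hM₀ : HasStrongType μ ρ₀ p₀ q₀ M₀ T)
    (hM₁ : HasStrongType μ ρ₁ p₁ q₁ M₁ T) (hT : IsMonotoneOperator μ T)
    (hρ₀ : IsNormFunction ρ₀) (hρ₁ : IsNormFunction ρ₁) (hθ₀ : 0 < θ) (hθ₁ : θ < 1)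
    (hp₀ : 0 < p₀) (hp₁ : 0 < p₁) (hq₀ : 0 < q₀) (hq₁ : 0 < q₁)
    (hp : 1 / p = (1 - θ) / p₀ + θ / p₁) (hq : 1 / q = (1 - θ) / q₀ + θ / q₁) :
    HasStrongType μ (interpNorm θ ρ₀ ρ₁) p q (3 * 2 ^ d * (M₀ ^ (1 - θ) * M₁ ^ θ)) T := by
  intro F hFX hF
  have hp' := pos_of_one_div_eq hθ₀ hθ₁ hp₀ hp₁ hp
  have hq' := pos_of_one_div_eq hθ₀ hθ₁ hq₀ hq₁ hq
  have hρ := hρ₀.interpNorm hρ₁ hθ₀ hθ₁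
  obtain ⟨A, hA₀, hA₁⟩ := isExhaustion_extremal hρ₀ hρ₁ hρ hp' (div_pos hp' hp₀)
    (div_pos hp' hp₁) hF
  have hA : IsExhaustion μ F A := ⟨hA₀.monotone, hA₀.measurableSet, hA₀.exists_mem, fun k =>
    indicator_mem_locIntBdd hFX (hA₀.measurableSet k)⟩
  calc normLpK μ q (ConvexSetValued.interpNorm θ ρ₀ ρ₁) (T F)
      ≤ normLpK μ q (ConvexSetValued.interpNorm θ ρ₀ ρ₁) (limAlong T F A) :=
        normLpK_mono hq' ((hT.ae_limAlong_eq hFX hA).mono fun _ hx => hx.ge)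
    _ = ⨆ k, normLpK μ q (ConvexSetValued.interpNorm θ ρ₀ ρ₁) (T ((A k).indicator F)) :=
        hT.normLpK_limAlong hρ hq' hF.1 hA
    _ ≤ _ := iSup_le fun k => normLpK_map_indicator_le hM₀ hM₁ hT hρ₀ hρ₁ hθ₀ hθ₁ hp₀ hp₁ hq₀ hq₁
        hp hq hF (hA.mem_locIntBdd k) (hA₀.mem_locIntBdd k) (hA₁.mem_locIntBdd k)

end Interpolation

section Extension

variable {d : ℕ} {Ω : Type*} [TopologicalSpace Ω] [MeasurableSpace Ω] {μ : Measure Ω}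
  {ρ : Ω → Euc d → ℝ} {F G : Ω → Set (Euc d)} {A : ℕ → Set Ω}
  {T : (Ω → Set (Euc d)) → Ω → Set (Euc d)} {p q : ℝ} {M : ℝ≥0}

/-- The functions to which `T` extends by continuity from below: `T` has limits in `𝒦_bcs` along
some exhaustion. -/
structure IsExtendable (μ : Measure Ω) (T : (Ω → Set (Euc d)) → Ω → Set (Euc d))
    (F : Ω → Set (Euc d)) : Prop where
  isKbcsFun : IsKbcsFun F
  exists_exhaustion : ∃ A, IsExhaustion μ F A ∧ ∀ᵐ x ∂μ, IsKbcs (limAlong T F A x)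

open Classical in
/-- The extension of `T` to the extendable functions by limits along exhaustions. It is set to `0`
on a measurable null set containing the points where the limit is not in `𝒦_bcs`, so that its
values are `𝒦_bcs`-valued functions everywhere. -/
noncomputable def extension (μ : Measure Ω) (T : (Ω → Set (Euc d)) → Ω → Set (Euc d))
    (F : Ω → Set (Euc d)) : Ω → Set (Euc d) :=
  if h : IsExtendable μ T F then
    (toMeasurable μ {x | ¬ IsKbcs (limAlong T F h.exists_exhaustion.choose x)})ᶜ.indicator
      (limAlong T F h.exists_exhaustion.choose)
  else 0

lemma IsMonotoneOperator.isKbcsFun_extension (hT : IsMonotoneOperator μ T)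
    (hF : IsExtendable μ T F) : IsKbcsFun (extension μ T F) := by
  rw [extension, dif_pos hF]
  refine ⟨fun x => ?_, (hT.setMeasurable_limAlong hF.exists_exhaustion.choose_spec.1).indicator
    (measurableSet_toMeasurable _ _).compl⟩
  by_cases hx : x ∈ toMeasurable μ {x | ¬ IsKbcs (limAlong T F hF.exists_exhaustion.choose x)}
  · rw [Set.indicator_of_notMem (not_not.2 hx)]
    exact .zero
  · rw [Set.indicator_of_mem hx]
    exact not_not.1 fun h => hx (subset_toMeasurable μ _ h)

lemma HasStrongType.isExtendable (hM : HasStrongType μ ρ p q M T) (hT : IsMonotoneOperator μ T)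
    (hρ : IsNormFunction ρ) (hp : 0 < p) (hq : 0 < q) (hF : F ∈ LpK μ p ρ) :
    IsExtendable μ T F := by
  have hA := hF.1.isExhaustion_radius_le
    ((hρ.measurable_supOn hF.1.measurable).ennreal_toReal.pow_const p)
    (fun _ => Real.rpow_nonneg ENNReal.toReal_nonneg p)
    (integrable_toReal_supOn_rpow hρ hp hF).locallyIntegrable fun x hx => by
      rw [Real.rpow_eq_zero ENNReal.toReal_nonneg hp.ne', ENNReal.toReal_eq_zero_iff] at hx
      exact (hρ.isGauge x).subset_zero_of_supOn_eq_zero (hx.resolve_right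
        ((hρ.isGauge x).supOn_lt_top (hF.1.isKbcs x).isBounded).ne)
  have hfin := (hM.normLpK_limAlong_le hT hρ hp hq hF hA).trans_lt
    (ENNReal.mul_lt_top ENNReal.coe_lt_top hF.2)
  refine ⟨hF.1, _, hA, ?_⟩
  filter_upwards [ae_supOn_lt_top hρ hq (hT.setMeasurable_limAlong hA) hfin,
    hT.ae_monotone hF.1 hA.monotone hA.mem_locIntBdd] with x hx hmono
  exact .closure_iUnion (fun k => hT.isKbcs (hA.mem_locIntBdd k) x) hmono
    (((hρ.isGauge x).isBounded_of_supOn_lt_top hx).subset subset_closure)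

variable [SecondCountableTopology Ω]

namespace IsMonotoneOperator

lemma ae_extension_eq_limAlong (hT : IsMonotoneOperator μ T) (hF : IsExtendable μ T F)
    (hA : IsExhaustion μ F A) : ∀ᵐ x ∂μ, extension μ T F x = limAlong T F A x := by
  obtain ⟨hB, hBk⟩ := hF.exists_exhaustion.choose_spec
  have hnull := (measure_toMeasurable _).trans (ae_iff.1 hBk)
  filter_upwards [measure_eq_zero_iff_ae_notMem.1 hnull,
    hT.ae_limAlong_eq_limAlong hF.isKbcsFun hB hA] with x hx hlim
  rw [extension, dif_pos hF, Set.indicator_of_mem hx, hlim]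

lemma ae_isKbcs_limAlong (hT : IsMonotoneOperator μ T) (hF : IsExtendable μ T F)
    (hA : IsExhaustion μ F A) : ∀ᵐ x ∂μ, IsKbcs (limAlong T F A x) :=
  (hT.ae_extension_eq_limAlong hF hA).mono fun x hx => hx ▸ (hT.isKbcsFun_extension hF).isKbcs x

lemma ae_extension_mono (hT : IsMonotoneOperator μ T) (hF : IsExtendable μ T F)
    (hG : IsExtendable μ T G) (hFG : ∀ x, F x ⊆ G x) :
    ∀ᵐ x ∂μ, extension μ T F x ⊆ extension μ T G x := by
  obtain ⟨A, hA, -⟩ := hG.exists_exhaustion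
  have hA' := hA.of_subset hF.isKbcsFun hFG
  filter_upwards [hT.ae_extension_eq_limAlong hF hA', hT.ae_extension_eq_limAlong hG hA,
    hT.ae_limAlong_mono hA' hA hFG] with x hF hG hsub
  rwa [hF, hG]

lemma ae_extension_smul (hT : IsMonotoneOperator μ T) (hF : IsExtendable μ T F) (c : ℝ) :
    ∀ᵐ x ∂μ, extension μ T (fun y => c • F y) x = c • extension μ T F x := by
  obtain ⟨A, hA, hAk⟩ := hF.exists_exhaustion
  have hlim := hT.ae_limAlong_smul hA c
  have hcF : IsExtendable μ T fun y => c • F y := ⟨hF.isKbcsFun.smul c, A, hA.smul c, by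
    filter_upwards [hAk, hlim] with x hx hlim
    exact hlim ▸ hx.smul c⟩
  filter_upwards [hT.ae_extension_eq_limAlong hF hA, hT.ae_extension_eq_limAlong hcF (hA.smul c),
    hlim] with x hF hcF hlim
  rw [hcF, hlim, hF]

lemma ae_extension_add (hT : IsMonotoneOperator μ T) (hF : IsExtendable μ T F)
    (hG : IsExtendable μ T G) :
    ∀ᵐ x ∂μ, extension μ T (fun y => F y + G y) x = extension μ T F x + extension μ T G x := by
  obtain ⟨A, hA, -⟩ := hF.exists_exhaustion
  obtain ⟨B, hB, -⟩ := hG.exists_exhaustion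
  have hFA := hA.inter hB
  have hGA : IsExhaustion μ G fun k => B k ∩ A k := by simpa only [Set.inter_comm] using hB.inter hA
  have hFk := hT.ae_isKbcs_limAlong hF hFA
  have hGk := hT.ae_isKbcs_limAlong hG hGA
  have hlim := hT.ae_limAlong_add hF.isKbcsFun hG.isKbcsFun hFA hGA
    (hFk.mono fun _ hx => hx.isCompact) (hGk.mono fun _ hx => hx.isCompact)
  have hFG : IsExtendable μ T fun y => F y + G y :=
    ⟨hF.isKbcsFun.add hG.isKbcsFun, _, hFA.add hGA, by
      filter_upwards [hFk, hGk, hlim] with x hF hG hlim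
      exact hlim ▸ hF.add hG⟩
  filter_upwards [hT.ae_extension_eq_limAlong hF hFA, hT.ae_extension_eq_limAlong hG hGA,
    hT.ae_extension_eq_limAlong hFG (hFA.add hGA), hlim] with x hF hG hFG hlim
  rw [hFG, hlim, hF, hG]

lemma isLinearMonotoneOn_extension (hT : IsMonotoneOperator μ T) {D : Set (Ω → Set (Euc d))}
    (hD : ∀ F ∈ D, IsExtendable μ T F) : IsLinearMonotoneOn μ D (extension μ T) where
  map_add F hF G hG := hT.ae_extension_add (hD F hF) (hD G hG)
  map_smul c F hF := hT.ae_extension_smul (hD F hF) c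
  mono F hF G hG := hT.ae_extension_mono (hD F hF) (hD G hG)

lemma ae_extension_eq (hT : IsMonotoneOperator μ T) (hF : F ∈ LocIntBdd μ d) :
    ∀ᵐ x ∂μ, extension μ T F x = T F x := by
  have hA : IsExhaustion μ F fun _ => Set.univ :=
    ⟨monotone_const, fun _ => .univ, fun _ => ⟨0, trivial⟩, fun _ => by rwa [Set.indicator_univ]⟩
  have hlim := hT.ae_limAlong_eq hF hA
  have hext : IsExtendable μ T F := ⟨hF.1, _, hA, hlim.mono fun x hx => hx ▸ hT.isKbcs hF x⟩
  filter_upwards [hT.ae_extension_eq_limAlong hext hA, hlim] with x hx hlim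
  rw [hx, hlim]

end IsMonotoneOperator

namespace HasStrongType

lemma normLpK_extension_le (hM : HasStrongType μ ρ p q M T) (hT : IsMonotoneOperator μ T)
    (hρ : IsNormFunction ρ) (hp : 0 < p) (hq : 0 < q) (hF : F ∈ LpK μ p ρ) :
    normLpK μ q ρ (extension μ T F) ≤ M * normLpK μ p ρ F := by
  have hext := hM.isExtendable hT hρ hp hq hF
  obtain ⟨A, hA, -⟩ := hext.exists_exhaustion
  exact (normLpK_mono hq ((hT.ae_extension_eq_limAlong hext hA).mono fun _ hx => hx.le)).trans
    (hM.normLpK_limAlong_le hT hρ hp hq hF hA)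

lemma extension_mem_LpK (hM : HasStrongType μ ρ p q M T) (hT : IsMonotoneOperator μ T)
    (hρ : IsNormFunction ρ) (hp : 0 < p) (hq : 0 < q) (hF : F ∈ LpK μ p ρ) :
    extension μ T F ∈ LpK μ q ρ :=
  ⟨hT.isKbcsFun_extension (hM.isExtendable hT hρ hp hq hF),
    (hM.normLpK_extension_le hT hρ hp hq hF).trans_lt
      (ENNReal.mul_lt_top ENNReal.coe_lt_top hF.2)⟩

end HasStrongType

end Extension

end ConvexSetValued

theorem theorem4p1_general {d : ℕ} {Ω : Type*} [TopologicalSpace Ω] [SecondCountableTopology Ω]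
    [MeasurableSpace Ω] {μ : Measure Ω} {p₀ p₁ q₀ q₁ : ℝ} (hp₀ : 0 < p₀) (hp₁ : 0 < p₁)
    (hq₀ : 0 < q₀) (hq₁ : 0 < q₁) {ρ₀ ρ₁ : Ω → Euc d → ℝ} (hρ₀ : IsNormFunction ρ₀)
    (hρ₁ : IsNormFunction ρ₁) {T : (Ω → Set (Euc d)) → Ω → Set (Euc d)}
    (hTX : ∀ F ∈ LocIntBdd μ d, T F ∈ LocIntBdd μ d)
    (hT : IsLinearMonotoneOn μ (LocIntBdd μ d) T) {M₀ M₁ : ℝ≥0}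
    (hM₀ : HasStrongType μ ρ₀ p₀ q₀ M₀ T) (hM₁ : HasStrongType μ ρ₁ p₁ q₁ M₁ T) {θ : ℝ}
    (hθ₀ : 0 < θ) (hθ₁ : θ < 1) {p q : ℝ} (hp : 1 / p = (1 - θ) / p₀ + θ / p₁)
    (hq : 1 / q = (1 - θ) / q₀ + θ / q₁) :
    ∃ M : ℝ≥0, HasStrongType μ (interpNorm θ ρ₀ ρ₁) p q M T ∧
      ∃ T' : (Ω → Set (Euc d)) → Ω → Set (Euc d),
        IsLinearMonotoneOn μ (LpK μ p (interpNorm θ ρ₀ ρ₁)) T' ∧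
        (∀ F ∈ LocIntBdd μ d, ∀ᵐ x ∂μ, T' F x = T F x) ∧
        ∀ F ∈ LpK μ p (interpNorm θ ρ₀ ρ₁), T' F ∈ LpK μ q (interpNorm θ ρ₀ ρ₁) ∧
          normLpK μ q (interpNorm θ ρ₀ ρ₁) (T' F) ≤ M * normLpK μ p (interpNorm θ ρ₀ ρ₁) F := by
  have hp' := pos_of_one_div_eq hθ₀ hθ₁ hp₀ hp₁ hp
  have hq' := pos_of_one_div_eq hθ₀ hθ₁ hq₀ hq₁ hq
  have hρ := hρ₀.interpNorm hρ₁ hθ₀ hθ₁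
  have hT := hM₀.isMonotoneOperator hρ₀ hp₀ hq₀ hTX hT
  have hM := hM₀.interpNorm hM₁ hT hρ₀ hρ₁ hθ₀ hθ₁ hp₀ hp₁ hq₀ hq₁ hp hq
  exact ⟨3 * 2 ^ d * (M₀ ^ (1 - θ) * M₁ ^ θ), hM, extension μ T,
    hT.isLinearMonotoneOn_extension fun F hF => hM.isExtendable hT hρ hp' hq' hF,
    fun F hF => hT.ae_extension_eq hF,
    fun F hF => ⟨hM.extension_mem_LpK hT hρ hp' hq' hF, hM.normLpK_extension_le hT hρ hp' hq' hF⟩⟩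

theorem theorem4p1 {n d : ℕ} (Ω : Set (EuclideanSpace ℝ (Fin n))) [MeasurableSpace Ω]
    (μ : Measure Ω) [SigmaFinite μ] [μ.IsComplete]
    (p₀ p₁ q₀ q₁ : ℝ) (hp₀ : 1 ≤ p₀) (hp₁ : 1 ≤ p₁) (hq₀ : 1 ≤ q₀) (hq₁ : 1 ≤ q₁)
    (ρ₀ ρ₁ : Ω → EuclideanSpace ℝ (Fin d) → ℝ)
    (hρ₀ : IsNormFunction ρ₀) (hρ₁ : IsNormFunction ρ₁)
    (T : (Ω → Set (EuclideanSpace ℝ (Fin d))) → Ω → Set (EuclideanSpace ℝ (Fin d)))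
    (hTX : ∀ F ∈ LocIntBdd μ d, T F ∈ LocIntBdd μ d)
    (hT : IsLinearMonotoneOn μ (LocIntBdd μ d) T)
    (M₀ M₁ : ℝ≥0)
    (hM₀ : ∀ F ∈ LocIntBdd μ d, F ∈ LpK μ p₀ ρ₀ →
      normLpK μ q₀ ρ₀ (T F) ≤ M₀ * normLpK μ p₀ ρ₀ F)
    (hM₁ : ∀ F ∈ LocIntBdd μ d, F ∈ LpK μ p₁ ρ₁ →
      normLpK μ q₁ ρ₁ (T F) ≤ M₁ * normLpK μ p₁ ρ₁ F)
    (hbdd : ∀ (A : Set Ω) (S : Set (EuclideanSpace ℝ (Fin d))), MeasurableSet A → IsKbcs S →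
      chi A S ∈ LocIntBdd μ d →
      (∃ C : ℝ≥0, ∀ x, supOn (ρ₀ x) (chi A S x) ≤ C ∧ supOn (ρ₁ x) (chi A S x) ≤ C) →
      ∃ C : ℝ≥0, ∀ᵐ x ∂μ, supOn (ρ₀ x) (T (chi A S) x) ≤ C ∧ supOn (ρ₁ x) (T (chi A S) x) ≤ C)
    (θ : ℝ) (hθ₀ : 0 < θ) (hθ₁ : θ < 1) (p q : ℝ)
    (hp : 1 / p = (1 - θ) / p₀ + θ / p₁) (hq : 1 / q = (1 - θ) / q₀ + θ / q₁) :
    ∃ M : ℝ≥0,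
      -- the bound on all of `X ∩ L^p_𝒦(Ω, ρ)`, in particular for simple functions
      (∀ F ∈ LocIntBdd μ d, F ∈ LpK μ p (interpNorm θ ρ₀ ρ₁) →
        normLpK μ q (interpNorm θ ρ₀ ρ₁) (T F) ≤ M * normLpK μ p (interpNorm θ ρ₀ ρ₁) F) ∧
      -- the bounded extension to all of `L^p_𝒦(Ω, ρ)`
      ∃ T' : (Ω → Set (EuclideanSpace ℝ (Fin d))) → Ω → Set (EuclideanSpace ℝ (Fin d)),
        IsLinearMonotoneOn μ (LpK μ p (interpNorm θ ρ₀ ρ₁)) T' ∧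
        (∀ F ∈ LocIntBdd μ d, F ∈ LpK μ p (interpNorm θ ρ₀ ρ₁) → ∀ᵐ x ∂μ, T' F x = T F x) ∧
        ∀ F ∈ LpK μ p (interpNorm θ ρ₀ ρ₁),
          T' F ∈ LpK μ q (interpNorm θ ρ₀ ρ₁) ∧
          normLpK μ q (interpNorm θ ρ₀ ρ₁) (T' F) ≤ M * normLpK μ p (interpNorm θ ρ₀ ρ₁) F := by
  obtain ⟨M, hM, T', hT', heq, hle⟩ := theorem4p1_general (by linarith) (by linarith) (by linarith)
    (by linarith) hρ₀ hρ₁ hTX hT hM₀ hM₁ hθ₀ hθ₁ hp hq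
  exact ⟨M, hM, T', hT', fun F hF _ => heq F hF, hle⟩
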